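/- Let $n\ge 1$, $d\ge 2$, and let $|\psi\rangle_{A_1\cdots A_n}=\sqrt{p}\,|W_n^d\rangle+\sqrt{1-p}\,|0\cdots0\rangle$ with $0\le p\le 1$ be an $n$-qudit GWV state, where $|W_n^d\rangle=\sum_{i=1}^{d-1}\left(a_{1i}|i0\cdots0\rangle+a_{2i}|0i\cdots0\rangle+\cdots+a_{ni}|0\cdots0i\rangle\right)$ and $\sum_{s=1}^{n}\sum_{i=1}^{d-1}|a_{si}|^2=1$. Let $\{P,P_0,\dots,P_{r-1}\}$, $r\ge 1$, be a partition into nonempty blocks of a set of parties $\{A_{i_1},\dots,A_{i_m}\}\subseteq\{A_1,\dots,A_n\}$. For disjoint sets $X,Y$ of parties let $\rho_{X|Y}$ (also written $\rho_{XY}$) be the reduced density matrix of $|\psi\rangle$ on $X\cup Y$, regarded as a bipartite state of $X$ and $Y$. For a bipartite pure state put $E_\alpha(|\phi\rangle_{XY})=S_\alpha(\operatorname{tr}_Y|\phi\rangle\langle\phi|)$, with $S_\alpha(\rho)=\frac{1}{1-\alpha}\log_2\operatorname{tr}\rho^\alpha$ for $\alpha\neq 1$ and $S_1(\rho)=-\operatorname{tr}\rho\log_2\rho$;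 for a bipartite mixed state put $E_\alpha(\rho)=\min\sum_i p_iE_\alpha(|\phi_i\rangle)$, the minimum being over all pure state decompositions $\rho=\sum_i p_i|\phi_i\rangle\langle\phi_i|$. Let $\alpha\in[\frac{\sqrt7-1}{2},\infty)$, $\beta\in[2,\infty)$, $0<k\le 1$, and $\mathcal K_\beta=\frac{(1+k)^{\beta/2}-1}{k^{\beta/2}}$. If $$k\,E_\alpha(\rho_{PP_l})^2\ \ge\ \sum_{j=l+1}^{r-1}E_\alpha(\rho_{PP_j})^2\qquad\text{for } l=0,1,\dots,r-2,$$ then $$E_\alpha(\rho_{P|P_0\cdots P_{r-1}})^\beta\ \ge\ \sum_{j=0}^{r-1}(\mathcal K_\beta)^{j}\,E_\alpha(\rho_{PP_j})^\beta .$$ -/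

import Mathlib

open scoped BigOperators

noncomputable section

/-! Multi-qudit systems: parties `Fin n`, local levels `Fin d`, with `0` the vacuum level.
A pure state of a system with index type `X` is a unit vector `X → ℂ`. -/

/-- The amplitudes of the `n`-qudit generalized W-class state
`∑ s, ∑ i ≠ 0, a s i |0 … 0 i 0 … 0⟩` with level `i` at party `s`. -/
def wState {n d : ℕ} [NeZero d] (a : Fin n → Fin d → ℂ) : (Fin n → Fin d) → ℂ :=
  fun c => ∑ s : Fin n, ∑ i ∈ Finset.univ.filter (fun i : Fin d => i ≠ 0),
    if c = Pi.single s i then a s i else 0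

/-- The vacuum state `|0 … 0⟩`. -/
def vacuumState {n d : ℕ} [NeZero d] : (Fin n → Fin d) → ℂ :=
  fun c => if c = 0 then 1 else 0

/-- GWV states: `√p |W⟩ + √(1 - p) |0 … 0⟩` with `0 ≤ p ≤ 1` and `|W⟩` a normalized generalized
W-class state. -/
def IsGWV {n d : ℕ} [NeZero d] (ψ : (Fin n → Fin d) → ℂ) : Prop :=
  ∃ (a : Fin n → Fin d → ℂ) (p : ℝ), 0 ≤ p ∧ p ≤ 1 ∧
    (∑ s : Fin n, ∑ i ∈ Finset.univ.filter (fun i : Fin d => i ≠ 0), ‖a s i‖ ^ 2 = 1) ∧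
    ψ = fun c => ((√p : ℝ) : ℂ) * wState a c + ((√(1 - p) : ℝ) : ℂ) * vacuumState c

/-- The rank-one matrix `|v⟩⟨v|`. -/
def ketBra {X : Type*} (v : X → ℂ) : Matrix X X ℂ :=
  Matrix.vecMulVec v (star v)

/-- The configuration of all parties that is `x` on `S` and `z` outside `S`. -/
def extendConfig {n d : ℕ} (S : Finset (Fin n)) (x : S → Fin d)
    (z : {i : Fin n // i ∉ S} → Fin d) : Fin n → Fin d :=
  fun i => if h : i ∈ S then x ⟨i, h⟩ else z ⟨i, h⟩

/-- The reduced density matrix `ρ_S` of the pure state `ψ`: the partial trace of `|ψ⟩⟨ψ|` over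
the parties outside `S`. -/
def reducedState {n d : ℕ} (ψ : (Fin n → Fin d) → ℂ) (S : Finset (Fin n)) :
    Matrix (S → Fin d) (S → Fin d) ℂ :=
  fun x x' => ∑ z : {i : Fin n // i ∉ S} → Fin d,
    ketBra ψ (extendConfig S x z) (extendConfig S x' z)

/-- For disjoint `A` and `B`, the identification of pairs of configurations of `A` and of `B` with
configurations of `A ∪ B`. -/
def mergeConfig {n d : ℕ} (A B : Finset (Fin n)) (xy : (A → Fin d) × (B → Fin d)) :
    (A ∪ B : Finset (Fin n)) → Fin d :=
  fun i => if h : i.1 ∈ A then xy.1 ⟨i.1, h⟩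
    else xy.2 ⟨i.1, (Finset.mem_union.mp i.2).resolve_left h⟩

/-- `ρ_{A|B}`: the reduced density matrix of `ψ` on the parties of `A ∪ B`, seen as a bipartite
state of `A` and `B` (for disjoint `A` and `B`). -/
def bipartiteReducedState {n d : ℕ} (ψ : (Fin n → Fin d) → ℂ) (A B : Finset (Fin n)) :
    Matrix ((A → Fin d) × (B → Fin d)) ((A → Fin d) × (B → Fin d)) ℂ :=
  (reducedState ψ (A ∪ B)).submatrix (mergeConfig A B) (mergeConfig A B)

/-- The partial trace over the second factor of a bipartite system. -/
def traceRight {X Y : Type*} [Fintype Y] (ρ : Matrix (X × Y) (X × Y) ℂ) : Matrix X X ℂ :=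
  fun x x' => ∑ y, ρ (x, y) (x', y)

theorem traceRight_ketBra_isHermitian {X Y : Type*} [Fintype Y] (v : X × Y → ℂ) :
    (traceRight (ketBra v)).IsHermitian := by
  ext x x'
  simp [traceRight, ketBra, Matrix.vecMulVec_apply, mul_comm]

/-- The Rényi-`α` entropy `(1 - α)⁻¹ log₂ (tr ρ ^ α)` of a density matrix, in terms of its
eigenvalues; at `α = 1` it is the von Neumann entropy `- tr (ρ log₂ ρ)`. -/
def renyiEntropy {X : Type*} [Fintype X] [DecidableEq X] (α : ℝ) (ρ : Matrix X X ℂ)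
    (h : ρ.IsHermitian) : ℝ :=
  if α = 1 then - ∑ i, h.eigenvalues i * Real.logb 2 (h.eigenvalues i)
  else 1 / (1 - α) * Real.logb 2 (∑ i, h.eigenvalues i ^ α)

/-- The Rényi-`α` entanglement of a bipartite pure state. -/
def pureRenyiEntanglement {X Y : Type*} [Fintype X] [DecidableEq X] [Fintype Y] (α : ℝ)
    (v : X × Y → ℂ) : ℝ :=
  renyiEntropy α (traceRight (ketBra v)) (traceRight_ketBra_isHermitian v)

/-- `q` and `v` form a pure state decomposition `ρ = ∑ i, q i |v i⟩⟨v i|`. -/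
def IsPureDecomposition {X : Type*} [Fintype X] (ρ : Matrix X X ℂ) {N : ℕ} (q : Fin N → ℝ)
    (v : Fin N → X → ℂ) : Prop :=
  (∀ i, 0 ≤ q i) ∧ ∑ i, q i = 1 ∧ (∀ i, ∑ x, ‖v i x‖ ^ 2 = 1) ∧
    ρ = ∑ i, (q i : ℂ) • ketBra (v i)

/-- The Rényi-`α` entanglement of a bipartite mixed state: the least average Rényi-`α`
entanglement over all pure state decompositions. -/
def renyiEntanglement {X Y : Type*} [Fintype X] [DecidableEq X] [Fintype Y] (α : ℝ)
    (ρ : Matrix (X × Y) (X × Y) ℂ) : ℝ :=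
  sInf {e : ℝ | ∃ (N : ℕ) (q : Fin N → ℝ) (v : Fin N → X × Y → ℂ),
    IsPureDecomposition ρ q v ∧ e = ∑ i, q i * pureRenyiEntanglement α (v i)}

/-- `E_α(ρ_{A|B})` for the reduced states of `ψ`. -/
def subsystemRenyiEntanglement {n d : ℕ} (α : ℝ) (ψ : (Fin n → Fin d) → ℂ)
    (A B : Finset (Fin n)) : ℝ :=
  renyiEntanglement α (bipartiteReducedState ψ A B)

/-- The weight `K_β = ((1 + k) ^ (β / 2) - 1) / k ^ (β / 2)`. -/
def weightK (k β : ℝ) : ℝ := ((1 + k) ^ (β / 2) - 1) / k ^ (β / 2)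

end

/-! A GWV state has at most one excited party. Tracing out everything outside `A ∪ B` therefore
leaves a rank-one term plus a multiple of the vacuum projector, and no vector in a pure
decomposition with positive weight has excitations on both sides. Such a vector has a one-sided
reduced matrix of rank at most two, so its entanglement is a function f = `concurrenceRenyi α` of
its concurrence C = 2√(w_l w_r), where w_l and w_r are the weights of its left and right
excitations.

For α ≥ (√7 - 1)/2, f is nondecreasing and convex on [0, 1]. Convexity is the analytic core: with C
= 1 / cosh t it reduces to the sign of an odd power series, whose coefficients are controlled by
`taylorCoeff_nonneg` and `taylorCoeff_nonpos`. Cauchy–Schwarz and Jensen then bound every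
decomposition from below, and an explicit two-term decomposition attains the bound. Hence
E_α(ρ_{A|B}) = f(2√(w_A w_B)) (`IsGWV.subsystemRenyiEntanglement_eq`), where w_S is the total
excitation weight of S.

Since w is additive over disjoint sets, the squared concurrences of P with the blocks add up.
Convexity and f(0) = 0 turn this into superadditivity of E_α² (`sum_concurrenceRenyi_sq_le`), and a
scalar inequality for powers β/2 (`sum_weightK_pow_mul_rpow_le`) supplies the weights. -/

/-! ### Signs of the Taylor coefficients. -/

/-- The Taylor coefficients, up to a factor `1 / k!`, of the function controlling convexity. -/
def taylorCoeff (c : ℝ) (k : ℕ) : ℝ :=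
  c * 3 ^ k + c + 4 - (2 + c) ^ k - (2 - c) ^ k - 4 * c ^ k

/-- Multiplying by 1 ± e adds e times the difference to the sum and e times the sum to the
difference, so the two bounds are proved by a joint induction. -/
theorem one_add_pow_add_one_sub_pow_ge {e : ℝ} (he : 0 ≤ e) (k : ℕ) :
    2 ≤ (1 + e) ^ k + (1 - e) ^ k ∧ 0 ≤ (1 + e) ^ k - (1 - e) ^ k := by
  induction k with
  | zero => norm_num
  | succ k ih =>
    obtain ⟨h1, h2⟩ := ih
    have a := mul_nonneg he h2
    have b : 0 ≤ e * ((1 + e) ^ k + (1 - e) ^ k) := mul_nonneg he (by linarith)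
    constructor <;> rw [pow_succ, pow_succ] <;> linarith

/-- With c = 1 + e, Bernoulli bounds (3 + e)^k and three of the four copies of (1 + e)^k; the fourth
is paired with (1 - e)^k. What remains is at most a nonpositive multiple of e (k - 3) 3^k. -/
theorem taylorCoeff_nonpos {c : ℝ} (hc : 1 ≤ c) {k : ℕ} (hk : 3 ≤ k) : taylorCoeff c k ≤ 0 := by
  obtain ⟨e, rfl⟩ : ∃ e, c = 1 + e := ⟨c - 1, by ring⟩
  have he : 0 ≤ e := by linarith
  have h1 := (one_add_pow_add_one_sub_pow_ge he k).1
  have h2 := one_add_mul_le_pow (show (-2 : ℝ) ≤ e by linarith) k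
  have h3 := one_add_mul_le_pow (show (-2 : ℝ) ≤ e / 3 by linarith) k
  have h4 : (3 + e) ^ k = 3 ^ k * (1 + e / 3) ^ k := by rw [← mul_pow]; congr 1; ring
  have h5 : (3 : ℝ) ^ k * (1 + k * (e / 3)) ≤ (3 + e) ^ k := by
    rw [h4]; exact mul_le_mul_of_nonneg_left h3 (by positivity)
  have hk' : (3 : ℝ) ≤ k := by exact_mod_cast hk
  have h6 : (1 : ℝ) ≤ 3 ^ k := one_le_pow₀ (by norm_num)
  have e1 : (2 : ℝ) + (1 + e) = 3 + e := by ring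
  have e2 : (2 : ℝ) - (1 + e) = 1 - e := by ring
  unfold taylorCoeff
  rw [e1, e2]
  have h7 : 0 ≤ e * (k - 3) * (3 ^ k) := by
    have : (0 : ℝ) ≤ k - 3 := by linarith
    positivity
  have h8 : 0 ≤ e * (k - 3) := mul_nonneg he (by linarith)
  nlinarith

theorem sqrt_seven_bounds : 2.64 < √7 ∧ √7 < 2.65 := by
  constructor
  · rw [Real.lt_sqrt] <;> norm_num
  · rw [Real.sqrt_lt'] <;> norm_num

theorem taylorCoeff_three (c : ℝ) : taylorCoeff c 3 = 4 * (1 - c) * (c ^ 2 + 4 * c - 3) := by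
  unfold taylorCoeff; ring

/-- The value √7 - 2 is the positive root of c² + 4c - 3, so the cubic coefficient vanishes there.
Going from k to k + 2 multiplies the coefficient by 9, which absorbs the 3^k term, and adds a
remainder that is positive for k ≥ 3. -/
theorem taylorCoeff_threshold_nonneg (j : ℕ) : 0 ≤ taylorCoeff (√7 - 2) (2 * j + 3) := by
  obtain ⟨h1, h2⟩ := sqrt_seven_bounds
  have hsq : √7 ^ 2 = 7 := Real.sq_sqrt (by norm_num)
  set c := √7 - 2 with hc
  have hc0 : 0.64 < c := by linarith
  have hc1 : c < 0.65 := by linarith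
  induction j with
  | zero =>
    have : c ^ 2 + 4 * c - 3 = 0 := by rw [hc]; ring_nf; rw [hsq]; ring
    rw [mul_zero, zero_add, taylorCoeff_three, this]; simp
  | succ j ih =>
    have key : taylorCoeff c (2 * (j + 1) + 3) = 9 * taylorCoeff c (2 * j + 3) +
        ((1 - c) * (5 + c) * (2 + c) ^ (2 * j + 3) + (1 + c) * (5 - c) * (2 - c) ^ (2 * j + 3)
          + 4 * (9 - c ^ 2) * c ^ (2 * j + 3) - 8 * (c + 4)) := by
      unfold taylorCoeff
      rw [show 2 * (j + 1) + 3 = (2 * j + 3) + 2 by ring]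
      simp only [pow_add _ (2 * j + 3) 2]
      ring
    have p1 : (18 : ℝ) ≤ (2 + c) ^ (2 * j + 3) :=
      calc (18 : ℝ) ≤ 2.64 ^ 3 := by norm_num
        _ ≤ (2 + c) ^ 3 := by gcongr; linarith
        _ ≤ _ := pow_le_pow_right₀ (by linarith) (by omega)
    have p2 : (2.4 : ℝ) ≤ (2 - c) ^ (2 * j + 3) :=
      calc (2.4 : ℝ) ≤ 1.35 ^ 3 := by norm_num
        _ ≤ (2 - c) ^ 3 := by gcongr; linarith
        _ ≤ _ := pow_le_pow_right₀ (by linarith) (by omega)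
    have q1 : (1.97 : ℝ) ≤ (1 - c) * (5 + c) := by nlinarith
    have q2 : (7 : ℝ) ≤ (1 + c) * (5 - c) := by nlinarith
    have m1 : (1.97 : ℝ) * 18 ≤ (1 - c) * (5 + c) * (2 + c) ^ (2 * j + 3) := by gcongr
    have m2 : (7 : ℝ) * 2.4 ≤ (1 + c) * (5 - c) * (2 - c) ^ (2 * j + 3) := by gcongr
    have m3 : 0 ≤ 4 * (9 - c ^ 2) * c ^ (2 * j + 3) := by
      have : 0 ≤ 9 - c ^ 2 := by nlinarith
      have : 0 ≤ c := by linarith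
      positivity
    rw [key]
    linarith

theorem concaveOn_taylorCoeff (k : ℕ) : ConcaveOn ℝ (Set.Icc 0 2) (fun c => taylorCoeff c k) := by
  have h1 : ConvexOn ℝ (Set.Icc (0 : ℝ) 2) (fun c => (2 + c) ^ k) := by
    refine ⟨convex_Icc _ _, fun x hx y hy a b ha hb hab => ?_⟩
    have := (convexOn_pow k).2 (x := 2 + x) (y := 2 + y) (by simp; linarith [hx.1])
      (by simp; linarith [hy.1]) ha hb hab
    simp only [smul_eq_mul] at this ⊢
    convert this using 2
    linear_combination (-2) * hab
  have h2 : ConvexOn ℝ (Set.Icc (0 : ℝ) 2) (fun c => (2 - c) ^ k) := by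
    refine ⟨convex_Icc _ _, fun x hx y hy a b ha hb hab => ?_⟩
    have := (convexOn_pow k).2 (x := 2 - x) (y := 2 - y) (by simp; linarith [hx.2])
      (by simp; linarith [hy.2]) ha hb hab
    simp only [smul_eq_mul] at this ⊢
    convert this using 2
    linear_combination (-2) * hab
  have h3 : ConvexOn ℝ (Set.Icc (0 : ℝ) 2) (fun c => c ^ k) :=
    (convexOn_pow k).subset (fun x hx => hx.1) (convex_Icc _ _)
  refine ⟨convex_Icc _ _, fun x hx y hy a b ha hb hab => ?_⟩
  have e1 := h1.2 hx hy ha hb hab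
  have e2 := h2.2 hx hy ha hb hab
  have e3 := h3.2 hx hy ha hb hab
  simp only [smul_eq_mul, taylorCoeff] at *
  have : (4 : ℝ) = a * 4 + b * 4 := by linear_combination (-4) * hab
  nlinarith

theorem taylorCoeff_one (k : ℕ) : taylorCoeff 1 k = 0 := by
  unfold taylorCoeff; norm_num; ring

/-- Each coefficient is concave in c, so on [√7 - 2, 1] it is at least its smaller endpoint value;
it is nonnegative at the left end and zero at 1. -/
theorem taylorCoeff_nonneg {c : ℝ} (hc : √7 - 2 ≤ c) (hc1 : c ≤ 1) (j : ℕ) :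
    0 ≤ taylorCoeff c (2 * j + 3) := by
  obtain ⟨h1, h2⟩ := sqrt_seven_bounds
  have := (concaveOn_taylorCoeff (2 * j + 3)).min_le_of_mem_Icc (x := √7 - 2) (y := 1) (z := c)
    ⟨by linarith, by linarith⟩ ⟨by norm_num, by norm_num⟩ ⟨hc, hc1⟩
  refine le_trans (le_min (taylorCoeff_threshold_nonneg j) ?_) this
  rw [taylorCoeff_one]

/-! ### Monotonicity of the entropy slope. -/

/-- The function whose sign is that of the derivative of the slope of the entropy. -/
noncomputable def slopeSign (c t : ℝ) : ℝ :=
  c * (Real.sinh (3 * t) + Real.sinh t) - Real.sinh ((2 + c) * t) - Real.sinh ((2 - c) * t)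
    + 4 * Real.sinh t - 4 * Real.sinh (c * t)

theorem hasSum_slopeSign (c t : ℝ) :
    HasSum (fun j : ℕ => taylorCoeff c (2 * j + 1) * (t ^ (2 * j + 1) / (2 * j + 1).factorial))
      (slopeSign c t) := by
  have h := ((((((Real.hasSum_sinh (3 * t)).add (Real.hasSum_sinh t)).mul_left c).sub
    (Real.hasSum_sinh ((2 + c) * t))).sub (Real.hasSum_sinh ((2 - c) * t))).add
    ((Real.hasSum_sinh t).mul_left 4)).sub ((Real.hasSum_sinh (c * t)).mul_left 4)
  have e : (fun j : ℕ => taylorCoeff c (2 * j + 1) * (t ^ (2 * j + 1) / (2 * j + 1).factorial)) =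
      fun j : ℕ => _ := funext fun j => by
    have : taylorCoeff c (2 * j + 1) * (t ^ (2 * j + 1) / (2 * j + 1).factorial) =
        c * ((3 * t) ^ (2 * j + 1) / (2 * j + 1).factorial +
          t ^ (2 * j + 1) / (2 * j + 1).factorial) -
          ((2 + c) * t) ^ (2 * j + 1) / (2 * j + 1).factorial -
          ((2 - c) * t) ^ (2 * j + 1) / (2 * j + 1).factorial +
          4 * (t ^ (2 * j + 1) / (2 * j + 1).factorial) -
          4 * ((c * t) ^ (2 * j + 1) / (2 * j + 1).factorial) := by
      simp only [mul_pow, taylorCoeff]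
      ring
    exact this
  rw [e]
  exact h

theorem taylorCoeff_first (c : ℝ) : taylorCoeff c 1 = 0 := by unfold taylorCoeff; ring

theorem slopeSign_nonneg {c t : ℝ} (hc : √7 - 2 ≤ c) (hc1 : c ≤ 1) (ht : 0 ≤ t) :
    0 ≤ slopeSign c t := by
  refine hasSum_le (fun j => ?_) hasSum_zero (hasSum_slopeSign c t)
  cases j with
  | zero => simp [taylorCoeff_first]
  | succ j => exact mul_nonneg (taylorCoeff_nonneg hc hc1 j) (by positivity)

theorem slopeSign_nonpos {c t : ℝ} (hc1 : 1 ≤ c) (ht : 0 ≤ t) : slopeSign c t ≤ 0 := by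
  refine hasSum_le (fun j => ?_) (hasSum_slopeSign c t) hasSum_zero
  cases j with
  | zero => simp [taylorCoeff_first]
  | succ j =>
    exact mul_nonpos_of_nonpos_of_nonneg (taylorCoeff_nonpos hc1 (by omega)) (by positivity)

/-- The slope of the Rényi entropy as a function of the concurrence `1 / cosh t`, up to a
positive factor. -/
noncomputable def entropySlope (α t : ℝ) : ℝ :=
  if α = 1 then t / Real.sinh t
  else Real.sinh ((α - 1) * t) / (α - 1) * Real.cosh t / (Real.sinh t * Real.cosh (α * t))

/-- The bracket is the quotient-rule numerator for `entropySlope`, without its factor 1 / (α - 1).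
Both sides are polynomials in sinh and cosh of t and αt, equal modulo cosh² = 1 + sinh². -/
theorem slopeSign_eq (α t : ℝ) : slopeSign (2 * α - 1) t =
    8 * ((Real.cosh ((α - 1) * t) * (α - 1) * Real.cosh t +
      Real.sinh ((α - 1) * t) * Real.sinh t) * (Real.sinh t * Real.cosh (α * t)) -
      Real.sinh ((α - 1) * t) * Real.cosh t * (Real.cosh t * Real.cosh (α * t) +
        Real.sinh t * (Real.sinh (α * t) * α))) := by
  have s1 : Real.sinh (3 * t) = 4 * Real.sinh t ^ 3 + 3 * Real.sinh t := Real.sinh_three_mul t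
  have s2 : Real.sinh ((2 + (2 * α - 1)) * t) = Real.sinh (2 * (α * t) + t) := by ring_nf
  have s3 : Real.sinh ((2 - (2 * α - 1)) * t) = Real.sinh (t + 2 * t - 2 * (α * t)) := by
    ring_nf
  have s4 : Real.sinh ((2 * α - 1) * t) = Real.sinh (2 * (α * t) - t) := by ring_nf
  have s5 : (α - 1) * t = α * t - t := by ring
  unfold slopeSign
  rw [s1, s2, s3, s4, s5]
  simp only [Real.sinh_add, Real.sinh_sub, Real.cosh_sub, Real.cosh_add, Real.sinh_two_mul,
    Real.cosh_two_mul]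
  have q1 := Real.cosh_sq t
  have q2 := Real.cosh_sq (α * t)
  clear s1 s2 s3 s4 s5
  generalize Real.sinh t = S at *
  generalize Real.cosh t = K at *
  generalize Real.sinh (α * t) = U at *
  generalize Real.cosh (α * t) = V at *
  grind

theorem sinh_mul_div_nonneg (a : ℝ) {t : ℝ} (ht : 0 < t) : 0 ≤ Real.sinh (a * t) / a := by
  rcases lt_trichotomy a 0 with h | h | h
  · exact div_nonneg_of_nonpos (Real.sinh_nonpos_iff.2 (by nlinarith)) h.le
  · simp [h]
  · exact div_nonneg (Real.sinh_nonneg_iff.2 (by positivity)) h.le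

theorem entropySlope_nonneg (α : ℝ) {t : ℝ} (ht : 0 < t) : 0 ≤ entropySlope α t := by
  have hs := Real.sinh_pos_iff.2 ht
  have hc := Real.cosh_pos t
  have hc' := Real.cosh_pos (α * t)
  have := sinh_mul_div_nonneg (α - 1) ht
  unfold entropySlope
  split_ifs <;> positivity

theorem entropySlope_antitoneOn {α : ℝ} (hα : (√7 - 1) / 2 ≤ α) :
    AntitoneOn (entropySlope α) (Set.Ioi 0) := by
  by_cases h1 : α = 1
  · subst h1
    have hd : ∀ t : ℝ, 0 < t → HasDerivAt (entropySlope 1)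
        ((1 * Real.sinh t - t * Real.cosh t) / Real.sinh t ^ 2) t := by
      intro t ht
      have e : entropySlope 1 = fun t => t / Real.sinh t := by ext; simp [entropySlope]
      rw [e]
      exact (hasDerivAt_id t).div (Real.hasDerivAt_sinh t) (Real.sinh_pos_iff.2 ht).ne'
    refine antitoneOn_of_deriv_nonpos (convex_Ioi 0)
      (fun t ht => (hd t ht).continuousAt.continuousWithinAt)
      (fun t ht => (hd t (by simpa using ht)).differentiableAt.differentiableWithinAt) ?_
    intro t ht
    rw [interior_Ioi] at ht
    rw [(hd t ht).deriv]
    refine div_nonpos_of_nonpos_of_nonneg ?_ (by positivity)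
    -- t / sinh t decreases because t cosh t - sinh t vanishes at 0 and has derivative t sinh t ≥ 0.
    have m : MonotoneOn (fun t => t * Real.cosh t - Real.sinh t) (Set.Ici 0) := by
      have hd2 : ∀ t : ℝ, HasDerivAt (fun t => t * Real.cosh t - Real.sinh t)
          (t * Real.sinh t) t := by
        intro t
        have := ((hasDerivAt_id t).mul (Real.hasDerivAt_cosh t)).sub (Real.hasDerivAt_sinh t)
        refine this.congr_deriv ?_
        simp
      refine monotoneOn_of_deriv_nonneg (convex_Ici 0)
        (fun t _ => (hd2 t).continuousAt.continuousWithinAt)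
        (fun t _ => (hd2 t).differentiableAt.differentiableWithinAt) ?_
      intro t ht
      rw [interior_Ici] at ht
      rw [(hd2 t).deriv]
      exact mul_nonneg (le_of_lt ht) (Real.sinh_nonneg_iff.2 (le_of_lt ht))
    have := m (Set.mem_Ici.2 le_rfl) (Set.mem_Ici.2 (le_of_lt ht)) (le_of_lt ht)
    simp at this
    linarith
  · have ha : α - 1 ≠ 0 := sub_ne_zero.2 h1
    have hd : ∀ t : ℝ, 0 < t → HasDerivAt (entropySlope α)
        (-(slopeSign (2 * α - 1) t / (1 - α)) / (8 * (Real.sinh t * Real.cosh (α * t)) ^ 2)) t := by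
      intro t ht
      have e : entropySlope α = fun t => Real.sinh ((α - 1) * t) / (α - 1) * Real.cosh t /
          (Real.sinh t * Real.cosh (α * t)) := by ext; simp [entropySlope, h1]
      have hs := Real.sinh_pos_iff.2 ht
      have hc' := Real.cosh_pos (α * t)
      have l : ∀ a : ℝ, HasDerivAt (fun t : ℝ => a * t) a t := fun a => by
        simpa using (hasDerivAt_id t).const_mul a
      have := ((((l (α - 1)).sinh).div_const (α - 1)).fun_mul (Real.hasDerivAt_cosh t)).fun_div
        ((Real.hasDerivAt_sinh t).fun_mul (l α).cosh) (mul_pos hs hc').ne'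
      rw [e]
      refine this.congr_deriv ?_
      rw [slopeSign_eq]
      field_simp
      ring
    refine antitoneOn_of_deriv_nonpos (convex_Ioi 0)
      (fun t ht => (hd t ht).continuousAt.continuousWithinAt)
      (fun t ht => (hd t (by simpa using ht)).differentiableAt.differentiableWithinAt) ?_
    intro t ht
    rw [interior_Ioi] at ht
    rw [(hd t ht).deriv]
    refine div_nonpos_of_nonpos_of_nonneg (neg_nonpos.2 ?_) (by positivity)
    -- With c = 2α - 1, the hypothesis on α is exactly c ≥ √7 - 2. The series and 1 - α both change
    -- sign at α = 1, so their quotient stays nonnegative.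
    rcases le_total α 1 with h | h
    · exact div_nonneg (slopeSign_nonneg (by linarith) (by linarith) (le_of_lt ht)) (by linarith)
    · exact div_nonneg_of_nonpos (slopeSign_nonpos (by linarith) (le_of_lt ht)) (by linarith)

/-! ### Convexity of the entropy in the concurrence. -/

/-- The Rényi-`α` entropy, in bits, of the distribution `(x, y)`. -/
noncomputable def binaryRenyi (α x y : ℝ) : ℝ :=
  if α = 1 then -(x * Real.logb 2 x + y * Real.logb 2 y)
  else 1 / (1 - α) * Real.logb 2 (x ^ α + y ^ α)

/-- The Rényi-`α` entanglement of a two-qubit pure state with concurrence `C`. -/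
noncomputable def concurrenceRenyi (α C : ℝ) : ℝ :=
  binaryRenyi α ((1 + √(1 - C ^ 2)) / 2) ((1 - √(1 - C ^ 2)) / 2)

theorem concurrenceRenyi_zero (α : ℝ) (hα : 0 < α) : concurrenceRenyi α 0 = 0 := by
  simp [concurrenceRenyi, binaryRenyi, Real.zero_rpow hα.ne']

theorem continuous_concurrenceRenyi {α : ℝ} (hα : 0 < α) : Continuous (concurrenceRenyi α) := by
  have hu : Continuous fun C : ℝ => √(1 - C ^ 2) := by fun_prop
  unfold concurrenceRenyi binaryRenyi
  split_ifs
  · have e : ∀ x : ℝ, x * Real.logb 2 x = (x * Real.log x) / Real.log 2 := by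
      intro x; rw [Real.logb]; ring
    simp only [e]
    have := Real.continuous_mul_log
    fun_prop
  · refine continuous_const.mul ?_
    have h1 : Continuous fun C : ℝ => ((1 + √(1 - C ^ 2)) / 2) ^ α :=
      (by fun_prop : Continuous fun C : ℝ => (1 + √(1 - C ^ 2)) / 2).rpow_const
        fun _ => Or.inr hα.le
    have h2 : Continuous fun C : ℝ => ((1 - √(1 - C ^ 2)) / 2) ^ α :=
      (by fun_prop : Continuous fun C : ℝ => (1 - √(1 - C ^ 2)) / 2).rpow_const
        fun _ => Or.inr hα.le
    unfold Real.logb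
    refine Continuous.div_const (Continuous.log (h1.add h2) fun C => ?_) _
    have a1 : 0 < (1 + √(1 - C ^ 2)) / 2 := by positivity
    have a2 : 0 ≤ (1 - √(1 - C ^ 2)) / 2 := by
      have : √(1 - C ^ 2) ≤ 1 := Real.sqrt_le_one.2 (by nlinarith [sq_nonneg C])
      linarith
    exact (add_pos_of_pos_of_nonneg (Real.rpow_pos_of_pos a1 _) (Real.rpow_nonneg a2 _)).ne'

/-- At C = 1 / cosh t the two eigenvalues are e^{±t} / (2 cosh t), so their powers and logarithms
become hyperbolic functions of t. -/
theorem hasDerivAt_concurrenceRenyi {α t : ℝ} (ht : 0 < t) :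
    HasDerivAt (concurrenceRenyi α) (α / Real.log 2 * entropySlope α t) (Real.cosh t)⁻¹ := by
  have hs := Real.sinh_pos_iff.2 ht
  have hc := Real.cosh_pos t
  have hcs := Real.cosh_sq t
  have hl2 : 0 < Real.log 2 := Real.log_pos (by norm_num)
  have hu2 : 1 - (Real.cosh t)⁻¹ ^ 2 = (Real.sinh t / Real.cosh t) ^ 2 := by
    field_simp; linarith
  have hu : √(1 - (Real.cosh t)⁻¹ ^ 2) = Real.sinh t / Real.cosh t := by
    rw [hu2, Real.sqrt_sq (by positivity)]
  have hder : HasDerivAt (fun C : ℝ => √(1 - C ^ 2)) (-(1 / Real.sinh t)) (Real.cosh t)⁻¹ := by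
    have h := (((hasDerivAt_id (Real.cosh t)⁻¹).fun_pow 2).const_sub 1).sqrt (by
      simp only [id]; rw [hu2]; positivity)
    simp only [id] at h
    refine h.congr_deriv ?_
    rw [hu]
    field_simp
    norm_num
    field_simp
  have hp : (1 + √(1 - (Real.cosh t)⁻¹ ^ 2)) / 2 = Real.exp t / (2 * Real.cosh t) := by
    rw [hu, ← Real.cosh_add_sinh]; field_simp
  have hm : (1 - √(1 - (Real.cosh t)⁻¹ ^ 2)) / 2 = Real.exp (-t) / (2 * Real.cosh t) := by
    rw [hu, ← Real.cosh_sub_sinh]; field_simp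
  have hpd := (hder.const_add 1).div_const 2
  have hmd := (hder.const_sub 1).div_const 2
  by_cases h1 : α = 1
  · subst h1
    have e : concurrenceRenyi 1 = fun C => -(((1 + √(1 - C ^ 2)) / 2) *
        Real.log ((1 + √(1 - C ^ 2)) / 2) + ((1 - √(1 - C ^ 2)) / 2) *
        Real.log ((1 - √(1 - C ^ 2)) / 2)) / Real.log 2 := by
      ext C; simp only [concurrenceRenyi, binaryRenyi, if_true, Real.logb]; ring
    rw [e]
    have hpl := HasDerivAt.comp (h := fun C : ℝ => (1 + √(1 - C ^ 2)) / 2) _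
      (Real.hasDerivAt_mul_log (by rw [hp]; positivity)) hpd
    have hml := HasDerivAt.comp (h := fun C : ℝ => (1 - √(1 - C ^ 2)) / 2) _
      (Real.hasDerivAt_mul_log (by rw [hm]; positivity)) hmd
    refine (((hpl.add hml).neg).div_const (Real.log 2)).congr_deriv ?_
    rw [hp, hm, Real.log_div (Real.exp_pos _).ne' (by positivity),
      Real.log_div (Real.exp_pos _).ne' (by positivity), Real.log_exp, Real.log_exp]
    simp only [entropySlope, if_true]
    field_simp
    ring
  · have e : concurrenceRenyi α = fun C => 1 / (1 - α) * (Real.log (((1 + √(1 - C ^ 2)) / 2) ^ α +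
        ((1 - √(1 - C ^ 2)) / 2) ^ α) / Real.log 2) := by
      ext C; simp only [concurrenceRenyi, binaryRenyi, if_neg h1, Real.logb]
    rw [e]
    have hpl := hpd.rpow_const (p := α) (Or.inl (by rw [hp]; positivity))
    have hml := hmd.rpow_const (p := α) (Or.inl (by rw [hm]; positivity))
    have hx : 0 < 2 * Real.cosh t := by positivity
    have key : ∀ s p : ℝ, (Real.exp s / (2 * Real.cosh t)) ^ p =
        Real.exp (p * s) / (2 * Real.cosh t) ^ p := by
      intro s p
      rw [Real.div_rpow (Real.exp_pos _).le hx.le, ← Real.exp_mul, mul_comm]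
    refine ((((hpl.add hml).log ?_).div_const (Real.log 2)).const_mul (1 / (1 - α))).congr_deriv ?_
    · simp only [Pi.add_apply]
      rw [hp, hm]; positivity
    · simp only [Pi.add_apply]
      rw [hp, hm]
      simp only [key]
      simp only [entropySlope, if_neg h1]
      have ha : α - 1 ≠ 0 := sub_ne_zero.2 h1
      have ha' : 1 - α ≠ 0 := fun h => ha (by linarith)
      have e1 : Real.exp (α * t) + Real.exp (α * -t) = 2 * Real.cosh (α * t) := by
        rw [Real.cosh_eq]; ring_nf
      have e2 : Real.exp ((α - 1) * t) - Real.exp ((α - 1) * -t) =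
          2 * Real.sinh ((α - 1) * t) := by
        rw [Real.sinh_eq]; ring_nf
      have e3 : (2 * Real.cosh t) ^ α = (2 * Real.cosh t) ^ (α - 1) * (2 * Real.cosh t) := by
        rw [Real.rpow_sub_one hx.ne']; field_simp
      have hX : 0 < (2 * Real.cosh t) ^ (α - 1) := by positivity
      have hca := Real.cosh_pos (α * t)
      rw [← add_div, e1, e3]
      have : -(1 / Real.sinh t) / 2 * α * (Real.exp ((α - 1) * t) / (2 * Real.cosh t) ^ (α - 1)) +
          -(-(1 / Real.sinh t)) / 2 * α *
            (Real.exp ((α - 1) * -t) / (2 * Real.cosh t) ^ (α - 1)) =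
          - α / (2 * Real.sinh t * (2 * Real.cosh t) ^ (α - 1)) *
            (2 * Real.sinh ((α - 1) * t)) := by
        rw [← e2]; field_simp; ring
      rw [this]
      field_simp
      ring

theorem exists_eq_inv_cosh {C : ℝ} (h0 : 0 < C) (h1 : C < 1) :
    ∃ t, 0 < t ∧ C = (Real.cosh t)⁻¹ := by
  have h : 1 < C⁻¹ := (one_lt_inv₀ h0).2 h1
  exact ⟨Real.arcosh C⁻¹, Real.arcosh_pos h, by rw [Real.cosh_arcosh h.le, inv_inv]⟩

theorem alpha_pos {α : ℝ} (hα : (√7 - 1) / 2 ≤ α) : 0 < α := by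
  have := sqrt_seven_bounds.1
  linarith

/-- Since 1 / cosh t decreases in t, a slope that is antitone in t is monotone in C. Continuity
covers the endpoints. -/
theorem convexOn_concurrenceRenyi {α : ℝ} (hα : (√7 - 1) / 2 ≤ α) :
    ConvexOn ℝ (Set.Icc 0 1) (concurrenceRenyi α) := by
  have h0 := alpha_pos hα
  refine MonotoneOn.convexOn_of_deriv (convex_Icc 0 1)
    (continuous_concurrenceRenyi h0).continuousOn ?_ ?_
  · intro C hC
    rw [interior_Icc] at hC
    obtain ⟨t, ht, rfl⟩ := exists_eq_inv_cosh hC.1 hC.2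
    exact (hasDerivAt_concurrenceRenyi ht).differentiableAt.differentiableWithinAt
  · intro C hC D hD hCD
    rw [interior_Icc] at hC hD
    obtain ⟨t, ht, rfl⟩ := exists_eq_inv_cosh hC.1 hC.2
    obtain ⟨s, hs, rfl⟩ := exists_eq_inv_cosh hD.1 hD.2
    rw [(hasDerivAt_concurrenceRenyi ht).deriv, (hasDerivAt_concurrenceRenyi hs).deriv]
    have hl2 : 0 < Real.log 2 := Real.log_pos (by norm_num)
    refine mul_le_mul_of_nonneg_left (entropySlope_antitoneOn hα hs ht ?_) (by positivity)
    rw [inv_le_inv₀ (Real.cosh_pos _) (Real.cosh_pos _), Real.cosh_le_cosh, abs_of_pos ht,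
      abs_of_pos hs] at hCD
    exact hCD

theorem monotoneOn_concurrenceRenyi {α : ℝ} (h0 : 0 < α) :
    MonotoneOn (concurrenceRenyi α) (Set.Icc 0 1) := by
  refine monotoneOn_of_deriv_nonneg (convex_Icc 0 1)
    (continuous_concurrenceRenyi h0).continuousOn ?_ ?_
  · intro C hC
    rw [interior_Icc] at hC
    obtain ⟨t, ht, rfl⟩ := exists_eq_inv_cosh hC.1 hC.2
    exact (hasDerivAt_concurrenceRenyi ht).differentiableAt.differentiableWithinAt
  · intro C hC
    rw [interior_Icc] at hC
    obtain ⟨t, ht, rfl⟩ := exists_eq_inv_cosh hC.1 hC.2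
    rw [(hasDerivAt_concurrenceRenyi ht).deriv]
    have hl2 : 0 < Real.log 2 := Real.log_pos (by norm_num)
    exact mul_nonneg (by positivity) (entropySlope_nonneg α ht)

theorem concurrenceRenyi_nonneg {α C : ℝ} (h0 : 0 < α) (hC : C ∈ Set.Icc (0 : ℝ) 1) :
    0 ≤ concurrenceRenyi α C := by
  rw [← concurrenceRenyi_zero α h0]
  exact monotoneOn_concurrenceRenyi h0 ⟨le_rfl, zero_le_one⟩ hC hC.1

/-- If the squared concurrences add up, then the squared entropies are superadditive. -/
theorem sum_concurrenceRenyi_sq_le {α : ℝ} (hα : (√7 - 1) / 2 ≤ α) {ι : Type*} (s : Finset ι)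
    (C : ι → ℝ) (hC : ∀ i, 0 ≤ C i) {D : ℝ} (hD : D ∈ Set.Icc (0 : ℝ) 1)
    (hsum : ∑ i ∈ s, C i ^ 2 = D ^ 2) :
    ∑ i ∈ s, concurrenceRenyi α (C i) ^ 2 ≤ concurrenceRenyi α D ^ 2 := by
  have h0 := alpha_pos hα
  have hle : ∀ i ∈ s, C i ≤ D := fun i hi => by
    refine (sq_le_sq₀ (hC i) hD.1).1 ?_
    rw [← hsum]
    exact Finset.single_le_sum (f := fun i => C i ^ 2) (fun i _ => sq_nonneg _) hi
  rcases hD.1.eq_or_lt with h | h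
  · subst h
    rw [concurrenceRenyi_zero α h0]
    refine le_of_eq ?_
    have : ∀ i ∈ s, concurrenceRenyi α (C i) ^ 2 = 0 := fun i hi => by
      rw [le_antisymm (hle i hi) (hC i), concurrenceRenyi_zero α h0]; norm_num
    rw [Finset.sum_eq_zero this]; norm_num
  · have key : ∀ i ∈ s, concurrenceRenyi α (C i) ^ 2 ≤
        C i ^ 2 * (concurrenceRenyi α D ^ 2 / D ^ 2) := by
      intro i hi
      have hm : C i ∈ Set.Icc (0 : ℝ) 1 := ⟨hC i, (hle i hi).trans hD.2⟩
      have hr : C i / D ≤ 1 := (div_le_one h).2 (hle i hi)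
      -- The graph lies below the chord from 0 to D, which gives f(C i) ≤ (C i / D) f(D).
      have := (convexOn_concurrenceRenyi hα).2 hD (⟨le_rfl, zero_le_one⟩ : (0 : ℝ) ∈ Set.Icc 0 1)
        (div_nonneg (hC i) h.le) (sub_nonneg.2 hr) (by ring)
      simp only [smul_eq_mul, concurrenceRenyi_zero α h0, mul_zero, add_zero] at this
      rw [div_mul_cancel₀ _ h.ne'] at this
      calc _ ≤ (C i / D * concurrenceRenyi α D) ^ 2 := by
            have := concurrenceRenyi_nonneg h0 hm
            gcongr
        _ = _ := by ring
    refine (Finset.sum_le_sum key).trans (le_of_eq ?_)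
    rw [← Finset.sum_mul, hsum]
    field_simp

/-! ### The weighted power inequality. -/

theorem weightK_nonneg {k β : ℝ} (hβ : 2 ≤ β) (hk0 : 0 < k) : 0 ≤ weightK k β := by
  unfold weightK
  have : 1 ≤ (1 + k) ^ (β / 2) := Real.one_le_rpow (by linarith) (by linarith)
  exact div_nonneg (by linarith) (by positivity)

/-- `((1 + t) ^ s - 1) / t ^ s` is nonincreasing in `t`. -/
theorem weightK_mul_rpow_le {k β t : ℝ} (hβ : 2 ≤ β) (hk0 : 0 < k) (ht0 : 0 ≤ t) (htk : t ≤ k) :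
    1 + weightK k β * t ^ (β / 2) ≤ (1 + t) ^ (β / 2) := by
  set s := β / 2 with hs
  have hs1 : 1 ≤ s := by rw [hs]; linarith
  rcases ht0.eq_or_lt with h | h
  · subst h
    rw [Real.zero_rpow (by linarith)]; simp
  have hconv := convexOn_rpow hs1
  have hts : 0 < t ^ s := by positivity
  have hks : 0 < k ^ s := by positivity
  have hr : t / k ≤ 1 := (div_le_one hk0).2 htk
  have hr0 : 0 < t / k := by positivity
  have hd : (t / k) ^ s = t ^ s / k ^ s := Real.div_rpow h.le hk0.le s
  have hm : (t / k * (1 + k)) ^ s = (t / k) ^ s * (1 + k) ^ s :=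
    Real.mul_rpow hr0.le (by linarith)
  -- The points t/k + t and 1 have the same sum as 1 + t and t/k and are convex combinations of them
  -- with swapped weights; adding the two convexity inequalities for x^s gives the claim.
  have main : (t / k * (1 + k)) ^ s + 1 ≤ (1 + t) ^ s + (t / k) ^ s := by
    have hpos : 0 < 1 + t - t / k := by linarith
    have hm1 : 1 + t ∈ Set.Ici (0 : ℝ) := Set.mem_Ici.2 (by linarith)
    have hm2 : t / k ∈ Set.Ici (0 : ℝ) := Set.mem_Ici.2 hr0.le
    have hp0 : 0 ≤ t / (1 + t - t / k) := div_nonneg h.le hpos.le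
    have hq0 : 0 ≤ (1 - t / k) / (1 + t - t / k) := div_nonneg (by linarith) hpos.le
    have hpq : t / (1 + t - t / k) + (1 - t / k) / (1 + t - t / k) = 1 := by
      rw [← add_div, div_eq_one_iff_eq hpos.ne']; ring
    have h1 := hconv.2 hm1 hm2 hp0 hq0 hpq
    have h2 := hconv.2 hm1 hm2 hq0 hp0 (by rw [add_comm]; exact hpq)
    have hne : 1 + t - t / k ≠ 0 := by linarith
    simp only [smul_eq_mul] at h1 h2
    have hk : k * (t / k) = t := by field_simp
    have e1 : t / (1 + t - t / k) * (1 + t) + (1 - t / k) / (1 + t - t / k) * (t / k) =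
        t / k * (1 + k) := by
      rw [div_mul_eq_mul_div, div_mul_eq_mul_div, ← add_div, div_eq_iff hne]
      linear_combination (-(1 + t - t / k)) * hk
    have e2 : (1 - t / k) / (1 + t - t / k) * (1 + t) + t / (1 + t - t / k) * (t / k) = 1 := by
      rw [div_mul_eq_mul_div, div_mul_eq_mul_div, ← add_div, div_eq_iff hne]
      ring
    rw [e1] at h1
    rw [e2, Real.one_rpow] at h2
    set p := t / (1 + t - t / k)
    set q := (1 - t / k) / (1 + t - t / k)
    have : q = 1 - p := by linarith
    rw [this] at h1 h2
    linarith
  have : weightK k β * t ^ s = (t / k * (1 + k)) ^ s - (t / k) ^ s := by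
    rw [hm, hd]; unfold weightK; rw [← hs]; field_simp
  rw [this]; linarith

theorem rpow_add_weightK_mul_le {k β x R : ℝ} (hβ : 2 ≤ β) (hk0 : 0 < k) (hx : 0 ≤ x) (hR : 0 ≤ R)
    (h : R ≤ k * x) : x ^ (β / 2) + weightK k β * R ^ (β / 2) ≤ (x + R) ^ (β / 2) := by
  rcases hx.eq_or_lt with h' | h'
  · subst h'
    have : R = 0 := by linarith
    subst this
    rw [Real.zero_rpow (by linarith), add_zero, Real.zero_rpow (by linarith)]; simp
  · have := weightK_mul_rpow_le hβ hk0 (t := R / x) (by positivity) ((div_le_iff₀ h').2 h)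
    have e : x + R = x * (1 + R / x) := by field_simp
    rw [e, Real.mul_rpow h'.le (by positivity)]
    rw [Real.div_rpow hR h'.le] at this
    have hxs : 0 < x ^ (β / 2) := by positivity
    calc _ = x ^ (β / 2) * (1 + weightK k β * (R ^ (β / 2) / x ^ (β / 2))) := by field_simp
      _ ≤ _ := by gcongr

/-- Peeling off the first entry leaves the tail sum as R in `rpow_add_weightK_mul_le`, and each
peeling costs one factor of `weightK k β`. -/
theorem sum_weightK_pow_mul_rpow_le {k β : ℝ} (hβ : 2 ≤ β) (hk0 : 0 < k) :
    ∀ (r : ℕ) (x : Fin r → ℝ), (∀ j, 0 ≤ x j) →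
      (∀ l : Fin r, (l : ℕ) + 1 < r → ∑ j ∈ Finset.Ioi l, x j ≤ k * x l) →
      ∑ j : Fin r, weightK k β ^ (j : ℕ) * x j ^ (β / 2) ≤ (∑ j, x j) ^ (β / 2) := by
  intro r
  induction r with
  | zero =>
    intro x _ _
    simpa using Real.rpow_nonneg le_rfl _
  | succ r ih =>
    intro x hx hcond
    have hK := weightK_nonneg hβ hk0
    have ih' := ih (fun j => x j.succ) (fun j => hx _) (fun l hl => by
      have := hcond l.succ (by simpa using hl)
      rwa [Fin.Ioi_succ, Finset.sum_map] at this)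
    rw [Fin.sum_univ_succ, Fin.sum_univ_succ]
    -- The hypothesis says nothing about the last index, but there the tail is empty and the bound
    -- is trivial.
    have hR : ∑ j : Fin r, x j.succ ≤ k * x 0 := by
      rcases Nat.eq_zero_or_pos r with h | h
      · subst h; simpa using mul_nonneg hk0.le (hx 0)
      · have := hcond 0 (by simpa using h)
        rwa [Fin.Ioi_zero_eq_map, Finset.sum_map] at this
    refine le_trans ?_ (rpow_add_weightK_mul_le hβ hk0 (hx 0)
      (Finset.sum_nonneg fun j _ => hx _) hR)
    have := mul_le_mul_of_nonneg_left ih' hK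
    rw [Finset.mul_sum] at this
    simp only [Fin.val_zero, pow_zero, one_mul, Fin.val_succ, pow_succ]
    refine add_le_add le_rfl (le_trans (le_of_eq ?_) this)
    exact Finset.sum_congr rfl fun j _ => by ring

/-! ### Entanglement of bipartite states without double excitations. -/

open Polynomial in
/-- If a Hermitian matrix has the form `B * B'` with `B' * B` a two by two matrix with
eigenvalues `x` and `y`, then `x` and `y` are its only possibly nonzero eigenvalues. -/
theorem Matrix.IsHermitian.sum_eigenvalues_eq_of_mul {m : Type*} [Fintype m] [DecidableEq m]
    {M : Matrix m m ℂ} (hM : M.IsHermitian) (B : Matrix m (Fin 2) ℂ) (B' : Matrix (Fin 2) m ℂ)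
    (hB : M = B * B') {x y : ℝ} (hx : (B' * B).trace = ((x + y : ℝ) : ℂ))
    (hy : (B' * B).det = ((x * y : ℝ) : ℂ)) (g : ℝ → ℝ) (hg : g 0 = 0) :
    ∑ i, g (hM.eigenvalues i) = g x + g y := by
  -- The characteristic polynomials of `B * B'` and `B' * B` agree up to powers of X. The extra
  -- roots are zeros, which contribute nothing because `g 0 = 0`.
  have h := Matrix.charpoly_mul_comm' B B'
  rw [← hB, Matrix.charpoly_fin_two, hx, hy] at h
  have e : (X ^ 2 - C ((x + y : ℝ) : ℂ) * X + C ((x * y : ℝ) : ℂ) : ℂ[X]) =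
      (X - C (x : ℂ)) * (X - C (y : ℂ)) := by
    push_cast
    simp only [C_add, C_mul]
    ring
  rw [e] at h
  have h2 := congrArg (fun p : ℂ[X] => (p.roots.map fun z => g z.re).sum) h
  have hne : M.charpoly ≠ 0 := (Matrix.charpoly_monic M).ne_zero
  rw [roots_mul (mul_ne_zero (pow_ne_zero _ X_ne_zero) hne),
    roots_mul (mul_ne_zero (pow_ne_zero _ X_ne_zero)
      (mul_ne_zero (X_sub_C_ne_zero _) (X_sub_C_ne_zero _))),
    roots_mul (mul_ne_zero (X_sub_C_ne_zero _) (X_sub_C_ne_zero _)),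
    hM.roots_charpoly_eq_eigenvalues] at h2
  simpa [roots_X_pow, hg, Multiset.map_nsmul, Multiset.sum_nsmul] using h2

section Bipartite

set_option linter.unusedSectionVars false

variable {X Y : Type*} [Fintype X] [DecidableEq X] [Fintype Y] [DecidableEq Y]

/-- The weight of the components of `v` where only the first system is excited. -/
noncomputable def leftWeight (x₀ : X) (y₀ : Y) (v : X × Y → ℂ) : ℝ :=
  ∑ x ∈ Finset.univ.erase x₀, ‖v (x, y₀)‖ ^ 2

/-- The weight of the components of `v` where only the second system is excited. -/
noncomputable def rightWeight (x₀ : X) (y₀ : Y) (v : X × Y → ℂ) : ℝ :=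
  ∑ y ∈ Finset.univ.erase y₀, ‖v (x₀, y)‖ ^ 2

theorem leftWeight_nonneg (x₀ : X) (y₀ : Y) (v : X × Y → ℂ) : 0 ≤ leftWeight x₀ y₀ v :=
  Finset.sum_nonneg fun _ _ => sq_nonneg _

theorem rightWeight_nonneg (x₀ : X) (y₀ : Y) (v : X × Y → ℂ) : 0 ≤ rightWeight x₀ y₀ v :=
  Finset.sum_nonneg fun _ _ => sq_nonneg _

theorem sum_norm_sq_eq_weights {x₀ : X} {y₀ : Y} {v : X × Y → ℂ}
    (hv : ∀ x y, x ≠ x₀ → y ≠ y₀ → v (x, y) = 0) :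
    ∑ z, ‖v z‖ ^ 2 = ‖v (x₀, y₀)‖ ^ 2 + leftWeight x₀ y₀ v + rightWeight x₀ y₀ v := by
  rw [Fintype.sum_prod_type, ← Finset.add_sum_erase _ _ (Finset.mem_univ x₀),
    ← Finset.add_sum_erase _ _ (Finset.mem_univ y₀)]
  have : ∀ x ∈ Finset.univ.erase x₀, ∑ y, ‖v (x, y)‖ ^ 2 = ‖v (x, y₀)‖ ^ 2 := fun x hx => by
    refine Finset.sum_eq_single y₀ (fun y _ hy => ?_) (by simp)
    rw [hv x y (Finset.ne_of_mem_erase hx) hy]; simp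
  rw [Finset.sum_congr rfl this]
  unfold leftWeight rightWeight
  ring

theorem two_mul_sqrt_mul_mem_Icc {a b : ℝ} (ha : 0 ≤ a) (hb : 0 ≤ b) (hab : a + b ≤ 1) :
    2 * √(a * b) ∈ Set.Icc (0 : ℝ) 1 := by
  refine ⟨by positivity, ?_⟩
  have : √(a * b) ≤ 1 / 2 := by
    rw [Real.sqrt_le_left (by norm_num)]
    nlinarith [sq_nonneg (a - b)]
  linarith

/-- The reduced matrix is |u⟩⟨u| + w_r |x₀⟩⟨x₀| with u = v(·, y₀), hence `B * B.conjTranspose` for a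
two-column `B`. The Gram matrix of `B` has trace 1 and determinant w_l w_r, so its eigenvalues are
(1 ± √(1 - 4 w_l w_r)) / 2. -/
theorem pureRenyiEntanglement_eq {α : ℝ} (hα : 0 < α) {x₀ : X} {y₀ : Y} {v : X × Y → ℂ}
    (hv : ∀ x y, x ≠ x₀ → y ≠ y₀ → v (x, y) = 0) (hn : ∑ z, ‖v z‖ ^ 2 = 1) :
    pureRenyiEntanglement α v =
      concurrenceRenyi α (2 * √(leftWeight x₀ y₀ v * rightWeight x₀ y₀ v)) := by
  set wl := leftWeight x₀ y₀ v with hwl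
  set wr := rightWeight x₀ y₀ v with hwr
  have hl : 0 ≤ wl := leftWeight_nonneg _ _ _
  have hr : 0 ≤ wr := rightWeight_nonneg _ _ _
  rw [sum_norm_sq_eq_weights hv] at hn
  have hsum : wl + wr ≤ 1 := by linarith [sq_nonneg ‖v (x₀, y₀)‖]
  have hD : (2 * √(wl * wr)) ^ 2 = 4 * (wl * wr) := by
    rw [mul_pow, Real.sq_sqrt (by positivity)]; norm_num
  have hC := two_mul_sqrt_mul_mem_Icc hl hr hsum
  set C := 2 * √(wl * wr) with hCdef
  have hu : √(1 - C ^ 2) ^ 2 = 1 - C ^ 2 := Real.sq_sqrt (by nlinarith [hC.1, hC.2])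
  set u := √(1 - C ^ 2) with hudef
  obtain ⟨B, hB0, hB1⟩ : ∃ B : Matrix X (Fin 2) ℂ, (∀ x, B x 0 = v (x, y₀)) ∧
      ∀ x, B x 1 = if x = x₀ then ((√wr : ℝ) : ℂ) else 0 :=
    ⟨Matrix.of fun x j => if j = 0 then v (x, y₀) else if x = x₀ then ((√wr : ℝ) : ℂ) else 0,
      by simp, by simp⟩
  have hsq : ((√wr : ℝ) : ℂ) * ((√wr : ℝ) : ℂ) = (wr : ℂ) := by
    rw [← Complex.ofReal_mul, Real.mul_self_sqrt hr]
  have hnorm : ∀ z : ℂ, z * star z = ((‖z‖ ^ 2 : ℝ) : ℂ) := fun z => by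
    rw [Complex.star_def, Complex.mul_conj, Complex.normSq_eq_norm_sq]
  have hB : traceRight (ketBra v) = B * B.conjTranspose := by
    ext x x'
    simp only [traceRight, ketBra, Matrix.vecMulVec_apply, Matrix.mul_apply, Fin.sum_univ_two,
      Matrix.conjTranspose_apply, hB0, hB1, Pi.star_apply]
    rw [← Finset.add_sum_erase _ _ (Finset.mem_univ y₀)]
    congr 1
    by_cases hx : x = x₀
    · by_cases hx' : x' = x₀
      · subst hx; subst hx'
        simp only [if_true, hnorm]
        rw [Complex.norm_real, Real.norm_of_nonneg (Real.sqrt_nonneg _), Real.sq_sqrt hr,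
          ← Complex.ofReal_sum]
        rfl
      · rw [Finset.sum_eq_zero]
        · simp [hx']
        · intro y hy
          rw [hv x' y hx' (Finset.ne_of_mem_erase hy)]; simp
    · rw [Finset.sum_eq_zero]
      · simp [hx]
      · intro y hy
        rw [hv x y hx (Finset.ne_of_mem_erase hy)]; simp
  have b00 : (B.conjTranspose * B) 0 0 = ((1 - wr : ℝ) : ℂ) := by
    simp only [Matrix.mul_apply, Matrix.conjTranspose_apply, hB0]
    have : ∀ x, star (v (x, y₀)) * v (x, y₀) = ((‖v (x, y₀)‖ ^ 2 : ℝ) : ℂ) := fun x => by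
      rw [mul_comm, hnorm]
    simp only [this]
    rw [← Complex.ofReal_sum, ← Finset.add_sum_erase _ _ (Finset.mem_univ x₀)]
    congr 1
    change _ + wl = _
    linarith
  have b01 : (B.conjTranspose * B) 0 1 = star (v (x₀, y₀)) * ((√wr : ℝ) : ℂ) := by
    simp [Matrix.mul_apply, hB0, hB1]
  have b10 : (B.conjTranspose * B) 1 0 = ((√wr : ℝ) : ℂ) * v (x₀, y₀) := by
    simp [Matrix.mul_apply, hB0, hB1, apply_ite]
  have b11 : (B.conjTranspose * B) 1 1 = (wr : ℂ) := by
    simp [Matrix.mul_apply, hB1, apply_ite, hsq]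
  have htr : (B.conjTranspose * B).trace = (((1 + u) / 2 + (1 - u) / 2 : ℝ) : ℂ) := by
    rw [Matrix.trace_fin_two, b00, b11]; push_cast; ring
  have hdet : (B.conjTranspose * B).det = (((1 + u) / 2 * ((1 - u) / 2) : ℝ) : ℂ) := by
    rw [Matrix.det_fin_two, b00, b11, b01, b10]
    have : star (v (x₀, y₀)) * ((√wr : ℝ) : ℂ) * (((√wr : ℝ) : ℂ) * v (x₀, y₀)) =
        ((‖v (x₀, y₀)‖ ^ 2 * wr : ℝ) : ℂ) := by
      rw [Complex.ofReal_mul, ← hnorm, ← hsq]; ring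
    rw [this, ← Complex.ofReal_mul, ← Complex.ofReal_sub]
    congr 1
    nlinarith
  have key := (traceRight_ketBra_isHermitian v).sum_eigenvalues_eq_of_mul B _ hB htr hdet
  unfold pureRenyiEntanglement renyiEntropy concurrenceRenyi binaryRenyi
  split_ifs
  · rw [key (fun x => x * Real.logb 2 x) (by simp)]
  · rw [key (fun x => x ^ α) (Real.zero_rpow hα.ne')]

theorem norm_sum_star_mul_le {ι : Type*} (s : Finset ι) (p w : ι → ℂ) :
    ‖∑ x ∈ s, star (p x) * w x‖ ≤ √(∑ x ∈ s, ‖p x‖ ^ 2) * √(∑ x ∈ s, ‖w x‖ ^ 2) := by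
  refine (norm_sum_le _ _).trans ?_
  simp only [norm_mul, norm_star]
  exact Real.sum_mul_le_sqrt_mul_sqrt s _ _

/-- The concurrence of a state without double excitations is at least that of its coherence
between the two systems, on average over any pure state decomposition. -/
theorem sqrt_mul_le_sum_weights {x₀ : X} {y₀ : Y} {ρ : Matrix (X × Y) (X × Y) ℂ} {φ : X × Y → ℂ}
    (hρ : ∀ x y, x ≠ x₀ → y ≠ y₀ → ρ (x, y₀) (x₀, y) = φ (x, y₀) * star (φ (x₀, y)))
    {N : ℕ} {q : Fin N → ℝ} {v : Fin N → X × Y → ℂ} (hd : IsPureDecomposition ρ q v) :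
    √(leftWeight x₀ y₀ φ * rightWeight x₀ y₀ φ) ≤
      ∑ i, q i * √(leftWeight x₀ y₀ (v i) * rightWeight x₀ y₀ (v i)) := by
  obtain ⟨hq, -, -, hdec⟩ := hd
  set A := leftWeight x₀ y₀ φ with hA
  set D := rightWeight x₀ y₀ φ with hD
  have hA0 : 0 ≤ A := leftWeight_nonneg _ _ _
  have hD0 : 0 ≤ D := rightWeight_nonneg _ _ _
  have hnorm : ∀ z : ℂ, star z * z = ((‖z‖ ^ 2 : ℝ) : ℂ) := fun z => by
    rw [mul_comm, Complex.star_def, Complex.mul_conj, Complex.normSq_eq_norm_sq]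
  -- These are the overlaps of the left and right excited parts of `v i` with those of φ. Pairing
  -- the coherence block of ρ with φ writes A D as the average of `a i * star (b i)`; Cauchy–Schwarz
  -- bounds each term, and one factor √(A D) cancels.
  let a : Fin N → ℂ := fun i => ∑ x ∈ Finset.univ.erase x₀, star (φ (x, y₀)) * v i (x, y₀)
  let b : Fin N → ℂ := fun i => ∑ y ∈ Finset.univ.erase y₀, star (φ (x₀, y)) * v i (x₀, y)
  have hAD : ((A * D : ℝ) : ℂ) = ∑ i, (q i : ℂ) * (a i * star (b i)) := by
    have h1 : ((A * D : ℝ) : ℂ) = ∑ x ∈ Finset.univ.erase x₀, ∑ y ∈ Finset.univ.erase y₀,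
        star (φ (x, y₀)) * ρ (x, y₀) (x₀, y) * φ (x₀, y) := by
      rw [hA, hD, leftWeight, rightWeight, Finset.sum_mul_sum, Complex.ofReal_sum]
      refine Finset.sum_congr rfl fun x hx => ?_
      rw [Complex.ofReal_sum]
      refine Finset.sum_congr rfl fun y hy => ?_
      rw [hρ x y (Finset.ne_of_mem_erase hx) (Finset.ne_of_mem_erase hy), Complex.ofReal_mul,
        ← hnorm, ← hnorm]
      ring
    rw [h1]
    have h2 : ∀ x y, ρ (x, y₀) (x₀, y) = ∑ i, (q i : ℂ) * (v i (x, y₀) * star (v i (x₀, y))) := by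
      intro x y
      rw [hdec, Matrix.sum_apply]
      rfl
    simp only [h2, a, b, star_sum, Finset.mul_sum, Finset.sum_mul, star_mul',
      star_star]
    rw [Finset.sum_comm]
    symm
    rw [Finset.sum_comm]
    refine Finset.sum_congr rfl fun y _ => ?_
    rw [Finset.sum_comm]
    refine Finset.sum_congr rfl fun x _ => Finset.sum_congr rfl fun i _ => ?_
    ring
  have hle : A * D ≤ √(A * D) * ∑ i, q i * √(leftWeight x₀ y₀ (v i) * rightWeight x₀ y₀ (v i)) := by
    have h1 : A * D = ‖((A * D : ℝ) : ℂ)‖ := by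
      rw [Complex.norm_real, Real.norm_of_nonneg (mul_nonneg hA0 hD0)]
    refine h1.trans_le ?_
    rw [hAD, Finset.mul_sum]
    refine (norm_sum_le _ _).trans (Finset.sum_le_sum fun i _ => ?_)
    rw [norm_mul, norm_mul, norm_star, Complex.norm_real, Real.norm_of_nonneg (hq i)]
    have ha := norm_sum_star_mul_le (Finset.univ.erase x₀) (fun x => φ (x, y₀))
      (fun x => v i (x, y₀))
    have hb := norm_sum_star_mul_le (Finset.univ.erase y₀) (fun y => φ (x₀, y))
      (fun y => v i (x₀, y))
    calc q i * (‖a i‖ * ‖b i‖) ≤ q i * ((√A * √(leftWeight x₀ y₀ (v i))) *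
          (√D * √(rightWeight x₀ y₀ (v i)))) := by
          refine mul_le_mul_of_nonneg_left (mul_le_mul ha hb (norm_nonneg _) (by positivity)) (hq i)
      _ = _ := by
          rw [Real.sqrt_mul hA0, Real.sqrt_mul (leftWeight_nonneg _ _ _)]; ring
  rcases (mul_nonneg hA0 hD0).eq_or_lt with h | h
  · rw [← h, Real.sqrt_zero]
    exact Finset.sum_nonneg fun i _ => mul_nonneg (hq i) (Real.sqrt_nonneg _)
  · refine le_of_mul_le_mul_left ?_ (Real.sqrt_pos.2 h)
    rwa [Real.mul_self_sqrt h.le]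

theorem ketBra_diag (v : X → ℂ) (x : X) : ketBra v x x = ((‖v x‖ ^ 2 : ℝ) : ℂ) := by
  rw [ketBra, Matrix.vecMulVec_apply, Pi.star_apply, Complex.star_def, Complex.mul_conj,
    Complex.normSq_eq_norm_sq]

theorem IsPureDecomposition.eq_zero_of_diag_eq_zero {ρ : Matrix X X ℂ} {N : ℕ} {q : Fin N → ℝ}
    {v : Fin N → X → ℂ} (hd : IsPureDecomposition ρ q v) {x : X} (hx : ρ x x = 0) {i : Fin N}
    (hi : q i ≠ 0) : v i x = 0 := by
  obtain ⟨hq, -, -, hdec⟩ := hd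
  have h : ((∑ i, q i * ‖v i x‖ ^ 2 : ℝ) : ℂ) = 0 := by
    rw [← hx, hdec, Matrix.sum_apply, Complex.ofReal_sum]
    refine Finset.sum_congr rfl fun i _ => ?_
    rw [Matrix.smul_apply, ketBra_diag, Complex.ofReal_mul, smul_eq_mul]
  rw [Complex.ofReal_eq_zero,
    Finset.sum_eq_zero_iff_of_nonneg fun i _ => mul_nonneg (hq i) (sq_nonneg _)] at h
  simpa [hi] using h i (Finset.mem_univ i)

/-- Vanishing double-excitation diagonal entries of ρ force the same on every vector of positive
weight, so each contributes f of its concurrence. Monotonicity of f applied to the averaged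
concurrence bound, then Jensen, finish. -/
theorem concurrenceRenyi_le_sum {α : ℝ} (hα : (√7 - 1) / 2 ≤ α) {x₀ : X} {y₀ : Y}
    {ρ : Matrix (X × Y) (X × Y) ℂ} {φ : X × Y → ℂ}
    (hρ : ∀ x y, x ≠ x₀ → y ≠ y₀ → ρ (x, y₀) (x₀, y) = φ (x, y₀) * star (φ (x₀, y)))
    (hρ0 : ∀ x y, x ≠ x₀ → y ≠ y₀ → ρ (x, y) (x, y) = 0)
    {N : ℕ} {q : Fin N → ℝ} {v : Fin N → X × Y → ℂ} (hd : IsPureDecomposition ρ q v) :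
    concurrenceRenyi α (2 * √(leftWeight x₀ y₀ φ * rightWeight x₀ y₀ φ)) ≤
      ∑ i, q i * pureRenyiEntanglement α (v i) := by
  have h0 := alpha_pos hα
  -- Vectors of weight zero are unconstrained; the value 0 keeps every `C i` in [0, 1], as Jensen
  -- requires.
  let C : Fin N → ℝ := fun i =>
    if q i = 0 then 0 else 2 * √(leftWeight x₀ y₀ (v i) * rightWeight x₀ y₀ (v i))
  have hv : ∀ i, q i ≠ 0 → ∀ x y, x ≠ x₀ → y ≠ y₀ → v i (x, y) = 0 := fun i hi x y hx hy =>
    hd.eq_zero_of_diag_eq_zero (hρ0 x y hx hy) hi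
  have hC : ∀ i, C i ∈ Set.Icc (0 : ℝ) 1 := fun i => by
    by_cases hi : q i = 0
    · simp [C, hi]
    · simp only [C, if_neg hi]
      refine two_mul_sqrt_mul_mem_Icc (leftWeight_nonneg _ _ _) (rightWeight_nonneg _ _ _) ?_
      have := hd.2.2.1 i
      rw [sum_norm_sq_eq_weights (hv i hi)] at this
      linarith [sq_nonneg ‖v i (x₀, y₀)‖]
  have hE : ∀ i, q i * pureRenyiEntanglement α (v i) = q i * concurrenceRenyi α (C i) := fun i => by
    by_cases hi : q i = 0
    · simp [hi]
    · simp only [C, if_neg hi]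
      rw [pureRenyiEntanglement_eq h0 (hv i hi) (hd.2.2.1 i)]
  have hle : 2 * √(leftWeight x₀ y₀ φ * rightWeight x₀ y₀ φ) ≤ ∑ i, q i * C i := by
    have := sqrt_mul_le_sum_weights hρ hd
    calc _ ≤ 2 * ∑ i, q i * √(leftWeight x₀ y₀ (v i) * rightWeight x₀ y₀ (v i)) := by linarith
      _ = _ := by
        rw [Finset.mul_sum]
        refine Finset.sum_congr rfl fun i _ => ?_
        by_cases hi : q i = 0
        · simp [hi]
        · simp only [C, if_neg hi]; ring
  have hmem : ∑ i, q i * C i ∈ Set.Icc (0 : ℝ) 1 :=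
    (convex_Icc (0 : ℝ) 1).sum_mem (fun i _ => hd.1 i) hd.2.1 (fun i _ => hC i)
  refine (monotoneOn_concurrenceRenyi h0 ⟨by positivity, hle.trans hmem.2⟩ hmem hle).trans ?_
  rw [Finset.sum_congr rfl fun i _ => hE i]
  exact (convexOn_concurrenceRenyi hα).map_sum_le (fun i _ => hd.1 i) hd.2.1 (fun i _ => hC i)

/-- A mixture of a state without double excitations and the vacuum has a decomposition into two
pure states with the same excited components. -/
theorem exists_isPureDecomposition {x₀ : X} {y₀ : Y} {φ : X × Y → ℂ} {c : ℝ} (hc : 0 ≤ c)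
    (him : (φ (x₀, y₀)).im = 0) (hn : ∑ z, ‖φ z‖ ^ 2 + c = 1) :
    ∃ (q : Fin 2 → ℝ) (v : Fin 2 → X × Y → ℂ),
      IsPureDecomposition (ketBra φ + (c : ℂ) • ketBra (Pi.single (x₀, y₀) 1)) q v ∧
      ∀ i z, z ≠ (x₀, y₀) → v i z = φ z := by
  -- The vectors are φ ± i√c |x₀ y₀⟩ with weight 1/2 each. Opposite signs cancel the cross terms in
  -- the mixture, and the factor i against the real amplitude φ(x₀, y₀) makes both vectors
  -- normalized.
  let s : Fin 2 → ℝ := ![√c, -√c]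
  have hs : ∀ i, s i ^ 2 = c := by
    intro i; fin_cases i <;> simp [s, Real.sq_sqrt hc]
  let v : Fin 2 → X × Y → ℂ := fun i z =>
    φ z + Complex.I * (s i : ℂ) * (Pi.single (x₀, y₀) 1 : X × Y → ℂ) z
  have hv : ∀ i z, z ≠ (x₀, y₀) → v i z = φ z := by
    intro i z hz
    simp [v, Pi.single_eq_of_ne hz]
  refine ⟨fun _ => 1 / 2, v, ⟨fun _ => by norm_num, by norm_num, fun i => ?_, ?_⟩, hv⟩
  · rw [← Finset.add_sum_erase _ _ (Finset.mem_univ (x₀, y₀))] at hn ⊢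
    rw [Finset.sum_congr rfl fun z hz => by rw [hv i z (Finset.ne_of_mem_erase hz)]]
    have : ‖v i (x₀, y₀)‖ ^ 2 = ‖φ (x₀, y₀)‖ ^ 2 + c := by
      rw [← Complex.normSq_eq_norm_sq, ← Complex.normSq_eq_norm_sq, Complex.normSq_apply,
        Complex.normSq_apply, ← hs i]
      simp [v, him]
      ring
    rw [this]
    linarith
  · ext z z'
    have hcc : (c : ℂ) = ((√c : ℝ) : ℂ) * ((√c : ℝ) : ℂ) := by
      rw [← Complex.ofReal_mul, Real.mul_self_sqrt hc]
    simp only [Matrix.add_apply, Matrix.smul_apply, Fin.sum_univ_two, ketBra,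
      Matrix.vecMulVec_apply, v, s, Pi.star_apply, smul_eq_mul, star_add, star_mul',
      Complex.star_def, Complex.conj_I, Complex.conj_ofReal, Matrix.cons_val_zero,
      Matrix.cons_val_one, Complex.ofReal_neg, map_neg, hcc]
    push_cast
    have hI : Complex.I * Complex.I = -1 := Complex.I_mul_I
    linear_combination (((√c : ℝ) : ℂ) * ((√c : ℝ) : ℂ) *
      (Pi.single (x₀, y₀) 1 : X × Y → ℂ) z *
      (starRingEnd ℂ) ((Pi.single (x₀, y₀) 1 : X × Y → ℂ) z')) * hI

/-- The lower bound is attained: both vectors of the two-term decomposition share the excited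
components of φ, hence its left and right weights. -/
theorem renyiEntanglement_eq {α : ℝ} (hα : (√7 - 1) / 2 ≤ α) {x₀ : X} {y₀ : Y} {φ : X × Y → ℂ}
    {c : ℝ} (hc : 0 ≤ c) (hφ : ∀ x y, x ≠ x₀ → y ≠ y₀ → φ (x, y) = 0)
    (him : (φ (x₀, y₀)).im = 0) (hn : ∑ z, ‖φ z‖ ^ 2 + c = 1) :
    renyiEntanglement α (ketBra φ + (c : ℂ) • ketBra (Pi.single (x₀, y₀) 1)) =
      concurrenceRenyi α (2 * √(leftWeight x₀ y₀ φ * rightWeight x₀ y₀ φ)) := by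
  have hlow : ∀ e ∈ {e : ℝ | ∃ (N : ℕ) (q : Fin N → ℝ) (v : Fin N → X × Y → ℂ),
      IsPureDecomposition (ketBra φ + (c : ℂ) • ketBra (Pi.single (x₀, y₀) 1)) q v ∧
      e = ∑ i, q i * pureRenyiEntanglement α (v i)},
      concurrenceRenyi α (2 * √(leftWeight x₀ y₀ φ * rightWeight x₀ y₀ φ)) ≤ e := by
    rintro e ⟨N, q, v, hd, rfl⟩
    refine concurrenceRenyi_le_sum hα ?_ ?_ hd
    · intro x y hx hy
      simp [ketBra, Matrix.vecMulVec_apply, hx, hy]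
    · intro x y hx hy
      simp [ketBra, Matrix.vecMulVec_apply, hx, hφ x y hx hy]
  refine IsLeast.csInf_eq ⟨?_, hlow⟩
  obtain ⟨q, v, hd, hv⟩ := exists_isPureDecomposition hc him hn
  refine ⟨2, q, v, hd, ?_⟩
  have : ∀ i, pureRenyiEntanglement α (v i) =
      concurrenceRenyi α (2 * √(leftWeight x₀ y₀ φ * rightWeight x₀ y₀ φ)) := fun i => by
    rw [pureRenyiEntanglement_eq (x₀ := x₀) (y₀ := y₀) (alpha_pos hα) _ (hd.2.2.1 i)]
    · have e1 : leftWeight x₀ y₀ (v i) = leftWeight x₀ y₀ φ :=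
        Finset.sum_congr rfl fun x hx => by rw [hv i]; simpa using hx
      have e2 : rightWeight x₀ y₀ (v i) = rightWeight x₀ y₀ φ :=
        Finset.sum_congr rfl fun y hy => by rw [hv i]; simpa using hy
      rw [e1, e2]
    · intro x y hx hy
      rw [hv i _ (by simp [hx]), hφ x y hx hy]
  simp only [this]
  rw [← Finset.sum_mul, hd.2.1, one_mul]

end Bipartite

/-! ### Reduced states of GWV states. -/

section Configurations

/-- A function on configurations is supported on at most one excitation if it vanishes as soon as
two parties are not in the vacuum level. -/
def AtMostOneExcitation {ι M : Type*} [Zero M] {d : ℕ} [NeZero d] (F : (ι → Fin d) → M) : Prop :=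
  ∀ c s t, s ≠ t → c s ≠ 0 → c t ≠ 0 → F c = 0

/-- A nonzero configuration with only one excited party is determined by that party and its nonzero
level. -/
theorem AtMostOneExcitation.sum_erase_zero {ι M : Type*} [Fintype ι] [DecidableEq ι]
    [AddCommMonoid M] {d : ℕ} [NeZero d] {F : (ι → Fin d) → M} (hF : AtMostOneExcitation F) :
    ∑ c ∈ Finset.univ.erase 0, F c =
      ∑ s : ι, ∑ i ∈ Finset.univ.filter (fun i : Fin d => i ≠ 0), F (Pi.single s i) := by
  rw [← Finset.sum_product' (s := Finset.univ)
    (t := Finset.univ.filter (fun i : Fin d => i ≠ 0)) (f := fun s i => F (Pi.single s i))]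
  symm
  refine Finset.sum_of_injOn (fun p : ι × Fin d => (Pi.single p.1 p.2 : ι → Fin d)) ?_ ?_ ?_ ?_
  · rintro ⟨s, i⟩ hs ⟨t, j⟩ ht h
    have hi : i ≠ 0 := by simpa using hs
    have h1 : (Pi.single s i : ι → Fin d) = Pi.single t j := h
    have h2 := congrFun h1 s
    rw [Pi.single_eq_same] at h2
    have hst : s = t := by
      by_contra hne
      rw [Pi.single_eq_of_ne hne] at h2
      exact hi h2
    subst hst
    rw [Pi.single_eq_same] at h2
    rw [h2]
  · rintro ⟨s, i⟩ hs
    have hi : i ≠ 0 := by simpa using hs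
    simpa using hi
  · intro c hc hnot
    have hc0 : c ≠ 0 := Finset.ne_of_mem_erase hc
    obtain ⟨s, hs⟩ := Function.ne_iff.1 hc0
    have hne : c ≠ Pi.single s (c s) := fun h => hnot ⟨(s, c s), by simpa using hs, h.symm⟩
    obtain ⟨t, ht⟩ := Function.ne_iff.1 hne
    have hts : t ≠ s := by
      rintro rfl
      simp at ht
    rw [Pi.single_eq_of_ne hts] at ht
    exact hF c s t hts.symm hs ht
  · intro p _
    rfl

variable {n d : ℕ} [NeZero d]

theorem wState_single (a : Fin n → Fin d → ℂ) (s : Fin n) {i : Fin d} (hi : i ≠ 0) :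
    wState a (Pi.single s i) = a s i := by
  unfold wState
  rw [Finset.sum_eq_single s, Finset.sum_eq_single i]
  · simp
  · intro j _ hj
    rw [if_neg]
    intro h
    exact hj (Pi.single_injective s h).symm
  · simp [hi]
  · intro t _ ht
    refine Finset.sum_eq_zero fun j _ => ?_
    rw [if_neg]
    intro h
    have := congrFun h s
    rw [Pi.single_eq_same, Pi.single_eq_of_ne ht.symm] at this
    exact hi this
  · simp

theorem wState_zero (a : Fin n → Fin d → ℂ) : wState a 0 = 0 := by
  unfold wState
  refine Finset.sum_eq_zero fun s _ => Finset.sum_eq_zero fun i hi => if_neg fun h => ?_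
  have := congrFun h s
  rw [Pi.single_eq_same] at this
  exact (Finset.mem_filter.1 hi).2 this.symm

theorem atMostOneExcitation_wState (a : Fin n → Fin d → ℂ) : AtMostOneExcitation (wState a) := by
  intro c s t hst hs ht
  unfold wState
  refine Finset.sum_eq_zero fun u _ => Finset.sum_eq_zero fun i hi => if_neg fun h => ?_
  subst h
  have h1 : s = u := by
    by_contra hne
    exact hs (Pi.single_eq_of_ne hne _)
  have h2 : t = u := by
    by_contra hne
    exact ht (Pi.single_eq_of_ne hne _)
  exact hst (h1.trans h2.symm)

/-- The probability that party `s` is the excited one. -/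
noncomputable def excitationWeight (ψ : (Fin n → Fin d) → ℂ) (s : Fin n) : ℝ :=
  ∑ i ∈ Finset.univ.filter (fun i : Fin d => i ≠ 0), ‖ψ (Pi.single s i)‖ ^ 2

theorem excitationWeight_nonneg (ψ : (Fin n → Fin d) → ℂ) (s : Fin n) :
    0 ≤ excitationWeight ψ s :=
  Finset.sum_nonneg fun _ _ => sq_nonneg _

theorem IsGWV.atMostOneExcitation {ψ : (Fin n → Fin d) → ℂ} (hψ : IsGWV ψ) :
    AtMostOneExcitation ψ := by
  obtain ⟨a, p, -, -, -, rfl⟩ := hψ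
  intro c s t hst hs ht
  have hc : c ≠ 0 := by
    rintro rfl
    exact hs rfl
  simp only [atMostOneExcitation_wState a c s t hst hs ht, vacuumState, if_neg hc, mul_zero,
    add_zero]

theorem IsGWV.apply_zero_im {ψ : (Fin n → Fin d) → ℂ} (hψ : IsGWV ψ) : (ψ 0).im = 0 := by
  obtain ⟨a, p, -, -, -, rfl⟩ := hψ
  simp [wState_zero, vacuumState]

theorem IsGWV.norm_eq_one {ψ : (Fin n → Fin d) → ℂ} (hψ : IsGWV ψ) :
    ‖ψ 0‖ ^ 2 + ∑ s, excitationWeight ψ s = 1 := by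
  obtain ⟨a, p, hp0, hp1, ha, rfl⟩ := hψ
  have h0 : ∀ s, ∀ i ∈ Finset.univ.filter (fun i : Fin d => i ≠ 0),
      ‖((√p : ℝ) : ℂ) * wState a (Pi.single s i) +
        ((√(1 - p) : ℝ) : ℂ) * vacuumState (Pi.single s i : Fin n → Fin d)‖ ^ 2 =
        p * ‖a s i‖ ^ 2 := fun s i hi => by
    have hi' := (Finset.mem_filter.1 hi).2
    rw [wState_single a s hi', vacuumState, if_neg (by simpa using hi')]
    rw [mul_zero, add_zero, norm_mul, mul_pow, Complex.norm_real,
      Real.norm_of_nonneg (Real.sqrt_nonneg _), Real.sq_sqrt hp0]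
  unfold excitationWeight
  rw [Finset.sum_congr rfl fun s _ => Finset.sum_congr rfl (h0 s)]
  simp only [← Finset.mul_sum]
  rw [ha, wState_zero, vacuumState, if_pos rfl, mul_zero, zero_add, mul_one, Complex.norm_real,
    Real.norm_of_nonneg (Real.sqrt_nonneg _), Real.sq_sqrt (by linarith)]
  ring

/-- The configuration that is `x` on `A`, `y` on `B` and `z` elsewhere. -/
def jointConfig (A B : Finset (Fin n)) (x : A → Fin d) (y : B → Fin d)
    (z : {i : Fin n // i ∉ A ∪ B} → Fin d) : Fin n → Fin d :=
  extendConfig (A ∪ B) (mergeConfig A B (x, y)) z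

variable {A B : Finset (Fin n)}

set_option linter.unusedSectionVars false

theorem jointConfig_left (x : A → Fin d) (y : B → Fin d) (z : {i : Fin n // i ∉ A ∪ B} → Fin d)
    {i : Fin n} (h : i ∈ A) : jointConfig A B x y z i = x ⟨i, h⟩ := by
  have h' : i ∈ A ∪ B := Finset.mem_union_left _ h
  simp [jointConfig, extendConfig, mergeConfig, h, h']

theorem jointConfig_right (hAB : Disjoint A B) (x : A → Fin d) (y : B → Fin d)
    (z : {i : Fin n // i ∉ A ∪ B} → Fin d) {i : Fin n} (h : i ∈ B) :
    jointConfig A B x y z i = y ⟨i, h⟩ := by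
  have h' : i ∈ A ∪ B := Finset.mem_union_right _ h
  have h'' : i ∉ A := Finset.disjoint_right.1 hAB h
  simp [jointConfig, extendConfig, mergeConfig, h'', h']

theorem jointConfig_outside (x : A → Fin d) (y : B → Fin d)
    (z : {i : Fin n // i ∉ A ∪ B} → Fin d) {i : Fin n} (h : i ∉ A ∪ B) :
    jointConfig A B x y z i = z ⟨i, h⟩ := by
  rw [jointConfig, extendConfig, dif_neg h]

theorem jointConfig_cases (hAB : Disjoint A B) {x : A → Fin d} {y : B → Fin d}
    {z : {i : Fin n // i ∉ A ∪ B} → Fin d} {c : Fin n → Fin d} (hx : ∀ i, x i = c i)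
    (hy : ∀ i, y i = c i) (hz : ∀ i, z i = c i) : jointConfig A B x y z = c := by
  ext i
  by_cases hA : i ∈ A
  · rw [jointConfig_left x y z hA, hx]
  · by_cases hB : i ∈ B
    · rw [jointConfig_right hAB x y z hB, hy]
    · rw [jointConfig_outside x y z (by simp [hA, hB]), hz]

theorem single_subtype_apply {p : Fin n → Prop} (s t : Subtype p) (i : Fin d) :
    (Pi.single s i : Subtype p → Fin d) t = (Pi.single s.1 i : Fin n → Fin d) t.1 := by
  simp [Pi.single_apply, Subtype.ext_iff]

theorem zero_eq_single_apply {s t : Fin n} (h : t ≠ s) (i : Fin d) :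
    0 = (Pi.single s i : Fin n → Fin d) t := by
  rw [Pi.single_eq_of_ne h]

variable {ψ : (Fin n → Fin d) → ℂ}

/-- This expresses the weight as a sum over parties, the source of additivity over disjoint blocks.
-/
theorem AtMostOneExcitation.leftWeight_eq (h : AtMostOneExcitation ψ) (hAB : Disjoint A B) :
    leftWeight 0 0 (fun xy : (A → Fin d) × (B → Fin d) => ψ (jointConfig A B xy.1 xy.2 0)) =
      ∑ s ∈ A, excitationWeight ψ s := by
  have hF : AtMostOneExcitation fun x : A → Fin d => ‖ψ (jointConfig A B x 0 0)‖ ^ 2 := by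
    intro c s t hst hs ht
    have : ψ (jointConfig A B c 0 0) = 0 := h _ s.1 t.1 (fun e => hst (Subtype.ext e))
      (by rwa [jointConfig_left _ _ _ s.2]) (by rwa [jointConfig_left _ _ _ t.2])
    simp [this]
  unfold leftWeight
  rw [hF.sum_erase_zero, ← Finset.sum_coe_sort A]
  refine Finset.sum_congr rfl fun s _ => Finset.sum_congr rfl fun i _ => ?_
  rw [jointConfig_cases hAB (c := Pi.single s.1 i)]
  · exact fun t => single_subtype_apply s t i
  · exact fun t => zero_eq_single_apply (fun e : t.1 = s.1 => Finset.disjoint_right.1 hAB t.2 (e ▸ s.2)) i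
  · exact fun t => zero_eq_single_apply
      (fun e : t.1 = s.1 => t.2 (Finset.mem_union_left _ (e ▸ s.2))) i

theorem AtMostOneExcitation.rightWeight_eq (h : AtMostOneExcitation ψ) (hAB : Disjoint A B) :
    rightWeight 0 0 (fun xy : (A → Fin d) × (B → Fin d) => ψ (jointConfig A B xy.1 xy.2 0)) =
      ∑ s ∈ B, excitationWeight ψ s := by
  have hF : AtMostOneExcitation fun y : B → Fin d => ‖ψ (jointConfig A B 0 y 0)‖ ^ 2 := by
    intro c s t hst hs ht
    have : ψ (jointConfig A B 0 c 0) = 0 := h _ s.1 t.1 (fun e => hst (Subtype.ext e))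
      (by rwa [jointConfig_right hAB _ _ _ s.2]) (by rwa [jointConfig_right hAB _ _ _ t.2])
    simp [this]
  unfold rightWeight
  rw [hF.sum_erase_zero, ← Finset.sum_coe_sort B]
  refine Finset.sum_congr rfl fun s _ => Finset.sum_congr rfl fun i _ => ?_
  rw [jointConfig_cases hAB (c := Pi.single s.1 i)]
  · exact fun t => zero_eq_single_apply (fun e : t.1 = s.1 => Finset.disjoint_left.1 hAB t.2 (e ▸ s.2)) i
  · exact fun t => single_subtype_apply s t i
  · exact fun t => zero_eq_single_apply
      (fun e : t.1 = s.1 => t.2 (Finset.mem_union_right _ (e ▸ s.2))) i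

theorem AtMostOneExcitation.outsideWeight_eq (h : AtMostOneExcitation ψ) (hAB : Disjoint A B) :
    ∑ z ∈ Finset.univ.erase 0, ‖ψ (jointConfig A B 0 0 z)‖ ^ 2 =
      ∑ s ∈ (A ∪ B)ᶜ, excitationWeight ψ s := by
  have hF : AtMostOneExcitation fun z : {i : Fin n // i ∉ A ∪ B} → Fin d =>
      ‖ψ (jointConfig A B 0 0 z)‖ ^ 2 := by
    intro c s t hst hs ht
    have : ψ (jointConfig A B 0 0 c) = 0 := h _ s.1 t.1 (fun e => hst (Subtype.ext e))
      (by rwa [jointConfig_outside _ _ _ s.2]) (by rwa [jointConfig_outside _ _ _ t.2])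
    simp [this]
  rw [hF.sum_erase_zero, Finset.sum_subtype (p := fun i => i ∉ A ∪ B) _
    (fun i => Finset.mem_compl)]
  refine Finset.sum_congr rfl fun s _ => Finset.sum_congr rfl fun i _ => ?_
  rw [jointConfig_cases hAB (c := Pi.single s.1 i)]
  · exact fun t => zero_eq_single_apply
      (fun e : t.1 = s.1 => s.2 (Finset.mem_union_left _ (e ▸ t.2))) i
  · exact fun t => zero_eq_single_apply
      (fun e : t.1 = s.1 => s.2 (Finset.mem_union_right _ (e ▸ t.2))) i
  · exact fun t => single_subtype_apply s t i

theorem AtMostOneExcitation.jointConfig_eq_zero (h : AtMostOneExcitation ψ) (hAB : Disjoint A B)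
    {x : A → Fin d} {y : B → Fin d} {z : {i : Fin n // i ∉ A ∪ B} → Fin d} (hz : z ≠ 0)
    (hxy : (x, y) ≠ (0, 0)) : ψ (jointConfig A B x y z) = 0 := by
  obtain ⟨u, hu⟩ := Function.ne_iff.1 hz
  have hu' : jointConfig A B x y z u.1 ≠ 0 := by rwa [jointConfig_outside _ _ _ u.2]
  by_cases hx : x = 0
  · have hy : y ≠ 0 := fun hy => hxy (by rw [hx, hy])
    obtain ⟨s, hs⟩ := Function.ne_iff.1 hy
    refine h _ s.1 u.1 (fun e => u.2 (Finset.mem_union_right _ (e ▸ s.2))) ?_ hu'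
    rwa [jointConfig_right hAB _ _ _ s.2]
  · obtain ⟨s, hs⟩ := Function.ne_iff.1 hx
    refine h _ s.1 u.1 (fun e => u.2 (Finset.mem_union_left _ (e ▸ s.2))) ?_ hu'
    rwa [jointConfig_left _ _ _ s.2]

theorem AtMostOneExcitation.jointConfig_eq_zero_of_ne (h : AtMostOneExcitation ψ)
    (hAB : Disjoint A B) {x : A → Fin d} {y : B → Fin d}
    {z : {i : Fin n // i ∉ A ∪ B} → Fin d} (hx : x ≠ 0) (hy : y ≠ 0) :
    ψ (jointConfig A B x y z) = 0 := by
  obtain ⟨s, hs⟩ := Function.ne_iff.1 hx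
  obtain ⟨t, ht⟩ := Function.ne_iff.1 hy
  refine h _ s.1 t.1 (fun e => Finset.disjoint_left.1 hAB s.2 (e ▸ t.2)) ?_ ?_
  · rwa [jointConfig_left _ _ _ s.2]
  · rwa [jointConfig_right hAB _ _ _ t.2]

/-- If the traced-out parties are in `z ≠ 0`, they hold the only excitation and `A ∪ B` is in the
vacuum; all coherence comes from `z = 0`. -/
theorem AtMostOneExcitation.bipartiteReducedState_eq (h : AtMostOneExcitation ψ)
    (hAB : Disjoint A B) :
    bipartiteReducedState ψ A B =
      ketBra (fun xy : (A → Fin d) × (B → Fin d) => ψ (jointConfig A B xy.1 xy.2 0)) +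
        ((∑ s ∈ (A ∪ B)ᶜ, excitationWeight ψ s : ℝ) : ℂ) • ketBra (Pi.single (0, 0) 1) := by
  ext ⟨x, y⟩ ⟨x', y'⟩
  have e : bipartiteReducedState ψ A B (x, y) (x', y') =
      ∑ z, ψ (jointConfig A B x y z) * star (ψ (jointConfig A B x' y' z)) := rfl
  rw [e, ← Finset.add_sum_erase _ _ (Finset.mem_univ 0), Matrix.add_apply, ← h.outsideWeight_eq hAB]
  congr 1
  rw [Matrix.smul_apply, ketBra, Matrix.vecMulVec_apply, Pi.star_apply]
  by_cases h1 : (x, y) = (0, 0)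
  · by_cases h2 : (x', y') = (0, 0)
    · rw [h1, h2, Pi.single_eq_same, star_one, mul_one, smul_eq_mul, mul_one, Complex.ofReal_sum]
      obtain ⟨rfl, rfl⟩ := Prod.mk.inj h1
      obtain ⟨rfl, rfl⟩ := Prod.mk.inj h2
      refine Finset.sum_congr rfl fun z _ => ?_
      rw [Complex.star_def, Complex.mul_conj, Complex.normSq_eq_norm_sq]
    · rw [Pi.single_eq_of_ne h2, star_zero, mul_zero, smul_zero]
      refine Finset.sum_eq_zero fun z hz => ?_
      rw [h.jointConfig_eq_zero hAB (Finset.ne_of_mem_erase hz) h2, star_zero, mul_zero]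
  · rw [Pi.single_eq_of_ne h1, zero_mul, smul_zero]
    refine Finset.sum_eq_zero fun z hz => ?_
    rw [h.jointConfig_eq_zero hAB (Finset.ne_of_mem_erase hz) h1, zero_mul]

theorem IsGWV.weights_le_one (hψ : IsGWV ψ) (hAB : Disjoint A B) :
    ∑ s ∈ A, excitationWeight ψ s + ∑ s ∈ B, excitationWeight ψ s ≤ 1 := by
  rw [← Finset.sum_union hAB, ← hψ.norm_eq_one]
  have := Finset.sum_le_univ_sum_of_nonneg (s := A ∪ B) (excitationWeight_nonneg ψ)
  linarith [sq_nonneg ‖ψ 0‖]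

/-- The Rényi entanglement between two disjoint sets of parties of a GWV state. -/
theorem IsGWV.subsystemRenyiEntanglement_eq {α : ℝ} (hα : (√7 - 1) / 2 ≤ α) (hψ : IsGWV ψ)
    (hAB : Disjoint A B) :
    subsystemRenyiEntanglement α ψ A B = concurrenceRenyi α
      (2 * √((∑ s ∈ A, excitationWeight ψ s) * ∑ s ∈ B, excitationWeight ψ s)) := by
  have h := hψ.atMostOneExcitation
  have hvan : ∀ (x : A → Fin d) (y : B → Fin d), x ≠ 0 → y ≠ 0 →
      ψ (jointConfig A B x y 0) = 0 := fun x y hx hy => h.jointConfig_eq_zero_of_ne hAB hx hy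
  have h00 : jointConfig A B 0 0 0 = (0 : Fin n → Fin d) :=
    jointConfig_cases hAB (fun _ => rfl) (fun _ => rfl) (fun _ => rfl)
  rw [subsystemRenyiEntanglement, h.bipartiteReducedState_eq hAB,
    renyiEntanglement_eq hα (Finset.sum_nonneg fun s _ => excitationWeight_nonneg ψ s) hvan,
    h.leftWeight_eq hAB, h.rightWeight_eq hAB]
  · simp only [h00]
    exact hψ.apply_zero_im
  · rw [sum_norm_sq_eq_weights hvan, h.leftWeight_eq hAB, h.rightWeight_eq hAB]
    simp only [h00]
    rw [← hψ.norm_eq_one, ← Finset.sum_add_sum_compl (A ∪ B), Finset.sum_union hAB]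
    ring

end Configurations

/-! ### Assembly of the inequality. -/

theorem theorem9 (n d : ℕ) [NeZero d] (ψ : (Fin n → Fin d) → ℂ) (hψ : IsGWV ψ)
    (r : ℕ) (P : Finset (Fin n)) (Q : Fin r → Finset (Fin n))
    (hP : P.Nonempty) (hQ : ∀ j, (Q j).Nonempty)
    (hPQ : ∀ j, Disjoint P (Q j)) (hQQ : ∀ i j, i ≠ j → Disjoint (Q i) (Q j))
    (α β k : ℝ) (hα : (√7 - 1) / 2 ≤ α) (hβ : 2 ≤ β) (hk0 : 0 < k) (hk1 : k ≤ 1)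
    (hcond : ∀ l : Fin r, (l : ℕ) + 1 < r →
      ∑ j ∈ Finset.Ioi l, subsystemRenyiEntanglement α ψ P (Q j) ^ 2
        ≤ k * subsystemRenyiEntanglement α ψ P (Q l) ^ 2) :
    ∑ j : Fin r, weightK k β ^ (j : ℕ) * subsystemRenyiEntanglement α ψ P (Q j) ^ β
      ≤ subsystemRenyiEntanglement α ψ P (Finset.univ.biUnion Q) ^ β := by
  have h0 := alpha_pos hα
  have hW : ∀ S : Finset (Fin n), 0 ≤ ∑ s ∈ S, excitationWeight ψ s := fun S =>
    Finset.sum_nonneg fun s _ => excitationWeight_nonneg ψ s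
  have hPU : Disjoint P (Finset.univ.biUnion Q) := by
    rw [Finset.disjoint_biUnion_right]
    exact fun j _ => hPQ j
  have hmem : ∀ S, Disjoint P S → 2 * √((∑ s ∈ P, excitationWeight ψ s) *
      ∑ s ∈ S, excitationWeight ψ s) ∈ Set.Icc (0 : ℝ) 1 := fun S hS =>
    two_mul_sqrt_mul_mem_Icc (hW P) (hW S) (hψ.weights_le_one hS)
  have hnn : ∀ S, Disjoint P S → 0 ≤ subsystemRenyiEntanglement α ψ P S := fun S hS => by
    rw [hψ.subsystemRenyiEntanglement_eq hα hS]
    exact concurrenceRenyi_nonneg h0 (hmem S hS)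
  have hpow : ∀ S, Disjoint P S → subsystemRenyiEntanglement α ψ P S ^ β =
      (subsystemRenyiEntanglement α ψ P S ^ 2) ^ (β / 2) := fun S hS => by
    rw [← Real.rpow_natCast, ← Real.rpow_mul (hnn S hS)]
    congr 1
    push_cast
    ring
  -- Each squared concurrence is 4 w_P w_S, and w_S is additive over the disjoint blocks.
  have hsq : ∑ j, subsystemRenyiEntanglement α ψ P (Q j) ^ 2 ≤
      subsystemRenyiEntanglement α ψ P (Finset.univ.biUnion Q) ^ 2 := by
    rw [hψ.subsystemRenyiEntanglement_eq hα hPU]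
    simp only [hψ.subsystemRenyiEntanglement_eq hα (hPQ _)]
    refine sum_concurrenceRenyi_sq_le hα _ _ (fun j => (hmem _ (hPQ j)).1) (hmem _ hPU) ?_
    have e : ∀ S : Finset (Fin n), (2 * √((∑ s ∈ P, excitationWeight ψ s) *
        ∑ s ∈ S, excitationWeight ψ s)) ^ 2 =
        4 * (∑ s ∈ P, excitationWeight ψ s) * ∑ s ∈ S, excitationWeight ψ s := fun S => by
      rw [mul_pow, Real.sq_sqrt (mul_nonneg (hW P) (hW S))]
      ring
    simp only [e]
    rw [← Finset.mul_sum, Finset.sum_biUnion fun i _ j _ hij => hQQ i j hij]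
  -- The power inequality is applied to the squared entanglements with exponent β/2, so the ordering
  -- hypothesis fits without change.
  rw [hpow _ hPU, Finset.sum_congr rfl fun j _ => by rw [hpow _ (hPQ j)]]
  refine (sum_weightK_pow_mul_rpow_le hβ hk0 r _ (fun j => sq_nonneg _) hcond).trans ?_
  exact Real.rpow_le_rpow (Finset.sum_nonneg fun j _ => sq_nonneg _) hsq (by linarith)
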